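/- Let $(M,g)$ be a smooth four-dimensional Lorentzian manifold of signature $(-,+,+,+)$, and let $\xi$ be a smooth Killing vector field on $M$ which is hypersurface-orthogonal wherever it is timelike: every point $p$ with $g_p(\xi,\xi)<0$ has an open neighbourhood carrying a smooth function $t$ with $dt\neq 0$ everywhere, whose level sets are orthogonal to $\xi$. Let $\Omega=\{p\in M: g_p(\xi,\xi)<0\}$ be the strictly static region. Let $R_{\mu\nu\alpha\beta}$ and $C_{\mu\nu\alpha\beta}$ be the Riemann and Weyl tensors of $g$, $K=R_{\mu\nu\alpha\beta}R^{\mu\nu\alpha\beta}$ the Kretschmann scalar and $W=C_{\mu\nu\alpha\beta}C^{\mu\nu\alpha\beta}$ the Weyl scalar. A static orthonormal frame at $p\in\Omega$ is a basis $(e_{\hat t},e_{\hat 1},e_{\hat 2},e_{\hat 3})$ of $T_pM$ with $g(e_{\hat a},e_{\hat b})=\mathrm{diag}(-1,1,1,1)_{ab}$ and $e_{\hat t}$ proportional to $\xi_p$; hatted indices denote components in such a frame, $\hat a,\hat b,\hat c,\hat d$ running over $\hat t,\hat 1,\hat 2,\hat 3$ and $\hat\imath,\hat\jmath,\hat k,\hat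 l$ over $\hat 1,\hat 2,\hat 3$. 1. At every point of $\Omega$ there is a static orthonormal frame, the extrinsic curvature of the hypersurface $t=\mathrm{const}$ orthogonal to $\xi$ vanishes, and in every static orthonormal frame $R_{\hat t\hat\imath\hat\jmath\hat k}=0$ and $C_{\hat t\hat\imath\hat\jmath\hat k}=0$. 2. At every point of $\Omega$, in every static orthonormal frame, $$K=\sum_{\hat a,\hat b,\hat c,\hat d}R_{\hat a\hat b\hat c\hat d}^2=\sum_{\hat\imath,\hat\jmath,\hat k,\hat l}R_{\hat\imath\hat\jmath\hat k\hat l}^2+4\sum_{\hat\imath,\hat\jmath}R_{\hat t\hat\imath\hat t\hat\jmath}^2\ \ge 0,\qquad W=\sum_{\hat a,\hat b,\hat c,\hat d}C_{\hat a\hat b\hat c\hat d}^2=\sum_{\hat\imath,\hat\jmath,\hat k,\hat l}C_{\hat\imath\hat\jmath\hat k\hat l}^2+4\sum_{\hat\imath,\hat\jmath}C_{\hat t\hat\imath\hat t\hat\jmath}^2\ \ge 0 .$$ 3. Consequently $|R_{\hat a\hat b\hat c\hat d}|\le\sqrt K$ and $|C_{\hat a\hat b\hat c\hat d}|\le\sqrt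 W$ at every point of $\Omega$ in every static orthonormal frame. In particular, if $K$ (respectively $W$) is bounded above on a set $S\subseteq\Omega$, for instance on $S=\Omega$, then all components $R_{\hat a\hat b\hat c\hat d}$ (respectively $C_{\hat a\hat b\hat c\hat d}$) in static orthonormal frames are bounded on $S$, uniformly in the point and the frame. -/

import Mathlib

open scoped Manifold ContDiff Topology

attribute [-instance] TopCat.of.chartedSpace

/-- The coordinate space of a spacetime. -/
abbrev CoordSpace : Type := EuclideanSpace ℝ (Fin 4)

/-- The Minkowski matrix `diag(-1, 1, 1, 1)`. -/
def minkowskiEta (a b : Fin 4) : ℝ :=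
  if a = b then (if a = 0 then -1 else 1) else 0

/-- A smooth Lorentzian metric, of signature `(-,+,+,+)`, on a smooth four-manifold. -/
structure LorentzianMetric (M : Type*) [TopologicalSpace M] [ChartedSpace CoordSpace M]
    [IsManifold (𝓡 4) ∞ M] where
  /-- The bilinear form on each tangent space. -/
  form (p : M) : TangentSpace (𝓡 4) p →L[ℝ] TangentSpace (𝓡 4) p →L[ℝ] ℝ
  symm (p : M) (u v : TangentSpace (𝓡 4) p) : form p u v = form p v u
  signature (p : M) : ∃ b : Module.Basis (Fin 4) ℝ (TangentSpace (𝓡 4) p),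
    ∀ a c, form p (b a) (b c) = minkowskiEta a c
  smooth : ContMDiff (𝓡 4) ((𝓡 4).prod 𝓘(ℝ, CoordSpace →L[ℝ] CoordSpace →L[ℝ] ℝ)) ∞
    (fun p ↦ Bundle.TotalSpace.mk' (CoordSpace →L[ℝ] CoordSpace →L[ℝ] ℝ) p (form p))

noncomputable section

section Coordinates

variable {M : Type*} [TopologicalSpace M] [ChartedSpace CoordSpace M]

/-- The coordinate vector field `∂_μ` of the chart `φ`, at the point with coordinates `x`. -/
def coordVec (φ : OpenPartialHomeomorph M CoordSpace) (μ : Fin 4) (x : CoordSpace) :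
    TangentSpace (𝓡 4) (φ.symm x) :=
  mfderiv (𝓡 4) (𝓡 4) φ.symm x (EuclideanSpace.single μ (1 : ℝ) : CoordSpace)

/-- The component `v^μ` in the chart `φ` of a tangent vector `v` at `p`. -/
def vecComp (φ : OpenPartialHomeomorph M CoordSpace) (p : M) (v : TangentSpace (𝓡 4) p)
    (μ : Fin 4) : ℝ :=
  let w : CoordSpace := mfderiv (𝓡 4) (𝓡 4) φ p v
  w μ

/-- The partial derivative `∂_μ f`. -/
def pd (μ : Fin 4) (f : CoordSpace → ℝ) (x : CoordSpace) : ℝ :=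
  fderiv ℝ f x (EuclideanSpace.single μ (1 : ℝ))

/-- The components `ξ^μ` in the chart `φ` of a vector field, as functions of the coordinates. -/
def fieldComp (φ : OpenPartialHomeomorph M CoordSpace) (ξ : ∀ p : M, TangentSpace (𝓡 4) p)
    (μ : Fin 4) (x : CoordSpace) : ℝ :=
  vecComp φ (φ.symm x) (ξ (φ.symm x)) μ

/-- The value `T(e_a, e_b, e_c, e_d)` of the covariant four-tensor at `p` whose components in the
chart `φ` are `T_{μναβ}`, on vectors of a frame `e`. -/
def frameComp (φ : OpenPartialHomeomorph M CoordSpace) (p : M)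
    (T : Fin 4 → Fin 4 → Fin 4 → Fin 4 → ℝ) (e : Fin 4 → TangentSpace (𝓡 4) p)
    (a b c d : Fin 4) : ℝ :=
  ∑ μ, ∑ ν, ∑ α, ∑ β, T μ ν α β *
    (vecComp φ p (e a) μ * vecComp φ p (e b) ν * vecComp φ p (e c) α * vecComp φ p (e d) β)

end Coordinates

/-- The total contraction `T_{μναβ} T^{μναβ}`, indices being raised with the matrix `h = (g^{μν})`. -/
def fullContraction (h : Matrix (Fin 4) (Fin 4) ℝ) (T : Fin 4 → Fin 4 → Fin 4 → Fin 4 → ℝ) : ℝ :=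
  ∑ μ, ∑ ν, ∑ α, ∑ β, T μ ν α β *
    ∑ μ', ∑ ν', ∑ α', ∑ β', h μ μ' * h ν ν' * h α α' * h β β' * T μ' ν' α' β'

namespace LorentzianMetric

variable {M : Type*} [TopologicalSpace M] [ChartedSpace CoordSpace M] [IsManifold (𝓡 4) ∞ M]
  (g : LorentzianMetric M) (φ : OpenPartialHomeomorph M CoordSpace)

/-! ### Curvature in the coordinates of a chart `φ` -/

/-- `g_{μν}`. -/
def lower (x : CoordSpace) : Matrix (Fin 4) (Fin 4) ℝ :=
  Matrix.of fun μ ν ↦ g.form (φ.symm x) (coordVec φ μ x) (coordVec φ ν x)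

/-- `g^{μν}`. -/
def upper (x : CoordSpace) : Matrix (Fin 4) (Fin 4) ℝ := (g.lower φ x)⁻¹

/-- `Γ^μ_{αβ}`. -/
def christoffel (μ α β : Fin 4) (x : CoordSpace) : ℝ :=
  (1 / 2) * ∑ ν, g.upper φ x μ ν *
    (pd α (fun y ↦ g.lower φ y ν β) x + pd β (fun y ↦ g.lower φ y ν α) x
      - pd ν (fun y ↦ g.lower φ y α β) x)

/-- `R^μ_{ναβ}`. -/
def riemannMixed (μ ν α β : Fin 4) (x : CoordSpace) : ℝ :=
  pd α (g.christoffel φ μ ν β) x - pd β (g.christoffel φ μ ν α) x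
    + ∑ σ, (g.christoffel φ μ σ α x * g.christoffel φ σ ν β x
      - g.christoffel φ μ σ β x * g.christoffel φ σ ν α x)

/-- `R_{μναβ}`. -/
def riemann (x : CoordSpace) (μ ν α β : Fin 4) : ℝ :=
  ∑ σ, g.lower φ x μ σ * g.riemannMixed φ σ ν α β x

/-- The Ricci tensor `R_{μν} = R^σ_{μσν}`. -/
def ricci (x : CoordSpace) (μ ν : Fin 4) : ℝ := ∑ σ, g.riemannMixed φ σ μ σ ν x

/-- The Ricci scalar `g^{μν} R_{μν}`. -/
def ricciScalar (x : CoordSpace) : ℝ := ∑ μ, ∑ ν, g.upper φ x μ ν * g.ricci φ x μ ν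

/-- The Weyl tensor `C_{μναβ}`, the trace-free part of the Riemann tensor in dimension four. -/
def weyl (x : CoordSpace) (μ ν α β : Fin 4) : ℝ :=
  g.riemann φ x μ ν α β
    - (1 / 2) * (g.lower φ x μ α * g.ricci φ x ν β - g.lower φ x μ β * g.ricci φ x ν α
      - g.lower φ x ν α * g.ricci φ x μ β + g.lower φ x ν β * g.ricci φ x μ α)
    + (1 / 6) * g.ricciScalar φ x *
      (g.lower φ x μ α * g.lower φ x ν β - g.lower φ x μ β * g.lower φ x ν α)

/-- The Kretschmann scalar `R_{μναβ} R^{μναβ}` at `p`. -/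
def kretschmann (p : M) : ℝ := fullContraction (g.upper φ (φ p)) (g.riemann φ (φ p))

/-- The Weyl scalar `C_{μναβ} C^{μναβ}` at `p`. -/
def weylScalar (p : M) : ℝ := fullContraction (g.upper φ (φ p)) (g.weyl φ (φ p))

/-! ### Static spacetimes -/

/-- Killing's equation `ℒ_ξ g = 0`, in all coordinates of the manifold. -/
def IsKilling (ξ : ∀ p : M, TangentSpace (𝓡 4) p) : Prop :=
  ∀ φ ∈ IsManifold.maximalAtlas (𝓡 4) ∞ M, ∀ x ∈ φ.target, ∀ μ ν : Fin 4,
    ∑ α, (fieldComp φ ξ α x * pd α (fun y ↦ g.lower φ y μ ν) x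
      + g.lower φ x μ α * pd ν (fieldComp φ ξ α) x
      + g.lower φ x α ν * pd μ (fieldComp φ ξ α) x) = 0

/-- The region in which the vector field `ξ` is timelike. -/
def timelikeRegion (ξ : ∀ p : M, TangentSpace (𝓡 4) p) : Set M :=
  {p | g.form p (ξ p) (ξ p) < 0}

/-- Every point at which `ξ` is timelike has a neighbourhood that is foliated by the level
hypersurfaces of a smooth function `t` (with nowhere zero differential) to which `ξ` is
orthogonal. -/
def IsHypersurfaceOrthogonal (ξ : ∀ p : M, TangentSpace (𝓡 4) p) : Prop :=
  ∀ p ∈ g.timelikeRegion ξ, ∃ (U : Set M) (t : M → ℝ), IsOpen U ∧ p ∈ U ∧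
    ContMDiffOn (𝓡 4) 𝓘(ℝ, ℝ) ∞ t U ∧
    ∀ q ∈ U, mfderiv (𝓡 4) 𝓘(ℝ, ℝ) t q ≠ 0 ∧
      ∀ v : TangentSpace (𝓡 4) q, mfderiv (𝓡 4) 𝓘(ℝ, ℝ) t q v = 0 → g.form q (ξ q) v = 0

/-- `ξ` is a static Killing field of `g`: a smooth Killing vector field that is
hypersurface-orthogonal where it is timelike. -/
structure IsStaticKilling (ξ : ∀ p : M, TangentSpace (𝓡 4) p) : Prop where
  smooth : ContMDiff (𝓡 4) (𝓡 4).tangent ∞ (fun p ↦ (⟨p, ξ p⟩ : TangentBundle (𝓡 4) M))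
  killing : g.IsKilling ξ
  hypersurfaceOrthogonal : g.IsHypersurfaceOrthogonal ξ

/-- An orthonormal basis of the tangent space at `p` whose timelike member is along `ξ`. -/
structure IsStaticFrame (ξ : ∀ p : M, TangentSpace (𝓡 4) p) (p : M)
    (e : Fin 4 → TangentSpace (𝓡 4) p) : Prop where
  orthonormal : ∀ a b, g.form p (e a) (e b) = minkowskiEta a b
  adapted : ∃ c : ℝ, e 0 = c • ξ p

/-- The covariant components `n_μ` of the unit normal `n = ξ / √(-g(ξ, ξ))` of the hypersurfaces
orthogonal to a timelike `ξ`. -/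
def unitNormal (ξ : ∀ p : M, TangentSpace (𝓡 4) p) (μ : Fin 4) (x : CoordSpace) : ℝ :=
  (∑ ν, g.lower φ x μ ν * fieldComp φ ξ ν x) /
    √(-(g.form (φ.symm x) (ξ (φ.symm x)) (ξ (φ.symm x))))

/-- The extrinsic curvature `X^μ Y^ν ∇_μ n_ν` at `p` of the hypersurfaces orthogonal to a timelike
`ξ`, on vectors `X`, `Y` tangent to the hypersurface through `p`. -/
def extrinsicCurvature (ξ : ∀ p : M, TangentSpace (𝓡 4) p) (p : M)
    (X Y : TangentSpace (𝓡 4) p) : ℝ :=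
  ∑ μ, ∑ ν, vecComp φ p X μ * vecComp φ p Y ν *
    (pd μ (g.unitNormal φ ξ ν) (φ p)
      - ∑ σ, g.christoffel φ σ μ ν (φ p) * g.unitNormal φ ξ σ (φ p))

end LorentzianMetric

end

/-!
Staticity enters through one local fact. Near a point where `ξ` is timelike, hypersurface
orthogonality says `ξ_μ = f ∂_μ τ` with smooth `f`, `τ` (`LorentzianMetric.exists_eq_mul_pd`).
Killing's equation `∇_μ ξ_ν + ∇_ν ξ_μ = 0` then leaves only the exterior derivative,
`∇_μ ξ_ν = (∂_μ f ∂_ν τ - ∂_ν f ∂_μ τ) / 2`, and also determines the Hessian `∇_μ ∇_ν τ` algebraically.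
Every term of `∇_μ ξ_ν` carries a factor `ξ`, so `∇ξ` vanishes on pairs of vectors orthogonal to `ξ`,
which is the vanishing of the extrinsic curvature. Differentiating once more and using the Ricci
identity, `R_{μναβ} ξ^μ = V_{αν} ξ_β - V_{βν} ξ_α` for some `V`
(`LorentzianMetric.exists_nablaField_eq_and_riemann_eq`), so that `R_{0ijk} = 0` in a static frame.
Hence `Ric_{0i} = 0`, and as the metric is diagonal in the frame, `C_{0ijk} = 0` too.

The rest is algebra. In an orthonormal frame the inverse metric is `∑ η_{aa} e_a ⊗ e_a`, so a full
contraction is the sum of squares of the frame components with the sign `(-1)^n`, where `n` is the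
number of time indices (`fullContraction_eq_sum_frameTensor`). By the symmetries of a curvature
tensor (`IsCurvatureLike`), components with three or four time indices vanish, those with one index
vanish by staticity, and all the remaining signs are `+`. The symmetries themselves are read off
from the expression of `R_{μναβ}` by Christoffel symbols of the first kind
(`LorentzianMetric.riemann_eq`). Static frames exist because a Lorentz boost (`boost`) takes the time
axis of any orthonormal frame to the direction of `ξ`.
-/

/-! ### Four-tensors in frames -/

/-- The components in the frame `E` (with `E a μ` the `μ`-th component of the vector `e_a`) of the
bilinear form with components `A`. -/
def frameForm (A : Fin 4 → Fin 4 → ℝ) (E : Fin 4 → Fin 4 → ℝ) (a b : Fin 4) : ℝ :=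
  ∑ μ, ∑ ν, A μ ν * (E a μ * E b ν)

/-- The components in the frame `E` of the four-tensor with components `T`. -/
def frameTensor (T : Fin 4 → Fin 4 → Fin 4 → Fin 4 → ℝ) (E : Fin 4 → Fin 4 → ℝ)
    (a b c d : Fin 4) : ℝ :=
  ∑ μ, ∑ ν, ∑ α, ∑ β, T μ ν α β * (E a μ * E b ν * E c α * E d β)

/-- The signs `η_{aa}` of the Minkowski metric. -/
def signEta (a : Fin 4) : ℝ := if a = 0 then -1 else 1

lemma minkowskiEta_eq (a b : Fin 4) :
    minkowskiEta a b = Matrix.diagonal signEta a b := by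
  simp only [minkowskiEta, Matrix.diagonal_apply, signEta]

lemma signEta_mul_self (a : Fin 4) : signEta a * signEta a = 1 := by
  unfold signEta; split_ifs <;> norm_num

/-- The inverse of a bilinear form with an orthonormal frame `E` is `∑ η_{aa} e_a ⊗ e_a`. -/
lemma inv_eq_of_frameForm {G : Matrix (Fin 4) (Fin 4) ℝ} {E : Fin 4 → Fin 4 → ℝ}
    (h : ∀ a b, frameForm G E a b = minkowskiEta a b) :
    IsUnit G.det ∧ ∀ μ ν, G⁻¹ μ ν = ∑ a, signEta a * E a μ * E a ν := by
  set A : Matrix (Fin 4) (Fin 4) ℝ := Matrix.of E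
  set D : Matrix (Fin 4) (Fin 4) ℝ := Matrix.diagonal signEta
  have h1 : A * (G * A.transpose) = D := by
    ext a b
    refine Eq.trans ?_ ((h a b).trans (minkowskiEta_eq a b))
    simp only [frameForm, Matrix.mul_apply, Matrix.transpose_apply, A, Matrix.of_apply, Finset.mul_sum]
    exact Finset.sum_congr rfl fun μ _ ↦ Finset.sum_congr rfl fun ν _ ↦ by ring
  have h2 : D * D = 1 := by
    simp only [D, Matrix.diagonal_mul_diagonal, signEta_mul_self, Matrix.diagonal_one]
  have h3 : A * (G * A.transpose * D) = 1 := by rw [← Matrix.mul_assoc, h1, h2]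
  have h4 : G * (A.transpose * D * A) = 1 := by
    rw [← mul_eq_one_comm.mp h3]; simp only [Matrix.mul_assoc]
  refine ⟨Matrix.isUnit_det_of_right_inverse h4, fun μ ν ↦ ?_⟩
  rw [Matrix.inv_eq_right_inv h4]
  rw [Matrix.mul_apply]
  simp only [D, Matrix.mul_diagonal, A, Matrix.transpose_apply, Matrix.of_apply]
  exact Finset.sum_congr rfl fun a _ ↦ by ring

/-- The algebraic symmetries of a curvature tensor (without the Bianchi identity). -/
structure IsCurvatureLike (T : Fin 4 → Fin 4 → Fin 4 → Fin 4 → ℝ) : Prop where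
  antisymm_left (a b c d : Fin 4) : T a b c d = -T b a c d
  antisymm_right (a b c d : Fin 4) : T a b c d = -T a b d c
  pair_symm (a b c d : Fin 4) : T a b c d = T c d a b

lemma sum_sum_mul_eq_sum_sq {ι κ : Type*} [Fintype ι] [Fintype κ] (T : ι → ℝ) (s : κ → ℝ)
    (F : κ → ι → ℝ) (H : ι → ι → ℝ) (hH : ∀ i j, H i j = ∑ a, s a * F a i * F a j) :
    ∑ i, T i * ∑ j, H i j * T j = ∑ a, s a * (∑ i, T i * F a i) ^ 2 := by
  calc ∑ i, T i * ∑ j, H i j * T j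
      = ∑ i, ∑ j, ∑ a, s a * ((T i * F a i) * (T j * F a j)) := by
        refine Finset.sum_congr rfl fun i _ ↦ ?_
        rw [Finset.mul_sum]
        refine Finset.sum_congr rfl fun j _ ↦ ?_
        rw [hH, Finset.sum_mul, Finset.mul_sum]
        exact Finset.sum_congr rfl fun a _ ↦ by ring
    _ = ∑ a, ∑ i, ∑ j, s a * ((T i * F a i) * (T j * F a j)) := by
        rw [Finset.sum_comm]
        simp only [Finset.sum_comm (s := (Finset.univ : Finset ι)) (t := (Finset.univ : Finset κ))]
        exact Finset.sum_congr rfl fun a _ ↦ Finset.sum_comm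
    _ = _ := by
        refine Finset.sum_congr rfl fun a _ ↦ ?_
        rw [sq, Finset.sum_mul_sum, Finset.mul_sum]
        exact Finset.sum_congr rfl fun i _ ↦ by rw [Finset.mul_sum]

/-- When the inverse metric is `∑ η_{aa} e_a ⊗ e_a`, a full contraction is the signed sum of the
squares of the frame components. -/
lemma fullContraction_eq_sum_frameTensor (h : Matrix (Fin 4) (Fin 4) ℝ) (E : Fin 4 → Fin 4 → ℝ)
    (hE : ∀ μ ν, h μ ν = ∑ a, signEta a * E a μ * E a ν)
    (T : Fin 4 → Fin 4 → Fin 4 → Fin 4 → ℝ) :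
    fullContraction h T = ∑ a, ∑ b, ∑ c, ∑ d,
      signEta a * signEta b * signEta c * signEta d * frameTensor T E a b c d ^ 2 := by
  have key := sum_sum_mul_eq_sum_sq (ι := Fin 4 × Fin 4 × Fin 4 × Fin 4)
    (κ := Fin 4 × Fin 4 × Fin 4 × Fin 4) (fun i ↦ T i.1 i.2.1 i.2.2.1 i.2.2.2)
    (fun a ↦ signEta a.1 * signEta a.2.1 * signEta a.2.2.1 * signEta a.2.2.2)
    (fun a i ↦ E a.1 i.1 * E a.2.1 i.2.1 * E a.2.2.1 i.2.2.1 * E a.2.2.2 i.2.2.2)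
    (fun i j ↦ h i.1 j.1 * h i.2.1 j.2.1 * h i.2.2.1 j.2.2.1 * h i.2.2.2 j.2.2.2) (by
      rintro ⟨i₁, i₂, i₃, i₄⟩ ⟨j₁, j₂, j₃, j₄⟩
      have h4 : ∀ f g k l : Fin 4 → ℝ, (∑ a, f a) * (∑ b, g b) * (∑ c, k c) * (∑ d, l d) =
          ∑ a, ∑ b, ∑ c, ∑ d, f a * g b * k c * l d := fun f g k l ↦ by
        simp only [← Finset.mul_sum, ← Finset.sum_mul]
      simp only [Fintype.sum_prod_type, hE, h4]
      refine Finset.sum_congr rfl fun a _ ↦ Finset.sum_congr rfl fun b _ ↦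
        Finset.sum_congr rfl fun c _ ↦ Finset.sum_congr rfl fun d _ ↦ ?_
      ring)
  simpa only [Fintype.sum_prod_type, fullContraction, frameTensor] using key

lemma IsCurvatureLike.frameTensor {T : Fin 4 → Fin 4 → Fin 4 → Fin 4 → ℝ} (hT : IsCurvatureLike T)
    (E : Fin 4 → Fin 4 → ℝ) : IsCurvatureLike (frameTensor T E) where
  antisymm_left a b c d := by
    unfold _root_.frameTensor
    rw [Finset.sum_comm]
    simp only [← Finset.sum_neg_distrib]
    refine Finset.sum_congr rfl fun μ _ ↦ Finset.sum_congr rfl fun ν _ ↦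
      Finset.sum_congr rfl fun α _ ↦ Finset.sum_congr rfl fun β _ ↦ ?_
    rw [hT.antisymm_left]; ring
  antisymm_right a b c d := by
    unfold _root_.frameTensor
    simp only [← Finset.sum_neg_distrib]
    refine Finset.sum_congr rfl fun μ _ ↦ Finset.sum_congr rfl fun ν _ ↦ ?_
    rw [Finset.sum_comm]
    refine Finset.sum_congr rfl fun α _ ↦ Finset.sum_congr rfl fun β _ ↦ ?_
    rw [hT.antisymm_right]; ring
  pair_symm a b c d := by
    unfold _root_.frameTensor
    have h1 : ∀ f : Fin 4 → Fin 4 → Fin 4 → Fin 4 → ℝ,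
        ∑ μ, ∑ ν, ∑ α, ∑ β, f μ ν α β = ∑ α, ∑ β, ∑ μ, ∑ ν, f μ ν α β := by
      intro f
      have h2 := Finset.sum_comm (s := (Finset.univ : Finset (Fin 4 × Fin 4)))
        (t := (Finset.univ : Finset (Fin 4 × Fin 4))) (f := fun x y ↦ f x.1 x.2 y.1 y.2)
      simpa only [Fintype.sum_prod_type] using h2
    rw [h1]
    refine Finset.sum_congr rfl fun μ _ ↦ Finset.sum_congr rfl fun ν _ ↦
      Finset.sum_congr rfl fun α _ ↦ Finset.sum_congr rfl fun β _ ↦ ?_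
    rw [hT.pair_symm]; ring

/-- In a signed sum of squares of curvature components only those with an even number of time
indices survive, as soon as the components with exactly one time index vanish. -/
lemma IsCurvatureLike.signed_sum_sq {S : Fin 4 → Fin 4 → Fin 4 → Fin 4 → ℝ}
    (hS : IsCurvatureLike S) (h0 : ∀ i j k : Fin 3, S 0 i.succ j.succ k.succ = 0) :
    (∑ a, ∑ b, ∑ c, ∑ d, signEta a * signEta b * signEta c * signEta d * S a b c d ^ 2 =
      (∑ i : Fin 3, ∑ j : Fin 3, ∑ k : Fin 3, ∑ l : Fin 3, S i.succ j.succ k.succ l.succ ^ 2)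
        + 4 * (∑ i : Fin 3, ∑ j : Fin 3, S 0 i.succ 0 j.succ ^ 2)) ∧
    (∑ a, ∑ b, ∑ c, ∑ d, S a b c d ^ 2 =
      (∑ i : Fin 3, ∑ j : Fin 3, ∑ k : Fin 3, ∑ l : Fin 3, S i.succ j.succ k.succ l.succ ^ 2)
        + 4 * (∑ i : Fin 3, ∑ j : Fin 3, S 0 i.succ 0 j.succ ^ 2)) := by
  have hl : ∀ a c d, S a a c d = 0 := fun a c d ↦ by linarith [hS.antisymm_left a a c d]
  have hr : ∀ a b c, S a b c c = 0 := fun a b c ↦ by linarith [hS.antisymm_right a b c c]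
  have h1 : ∀ i j k : Fin 3, S i.succ 0 j.succ k.succ = 0 := fun i j k ↦ by
    rw [hS.antisymm_left, h0, neg_zero]
  have h2 : ∀ i j k : Fin 3, S j.succ k.succ 0 i.succ = 0 := fun i j k ↦ by
    rw [hS.pair_symm, h0]
  have h3 : ∀ i j k : Fin 3, S j.succ k.succ i.succ 0 = 0 := fun i j k ↦ by
    rw [hS.pair_symm, h1]
  have e1 : ∀ i j : Fin 3, S i.succ 0 0 j.succ = -S 0 i.succ 0 j.succ := fun i j ↦
    hS.antisymm_left _ _ _ _
  have e2 : ∀ i j : Fin 3, S 0 i.succ j.succ 0 = -S 0 i.succ 0 j.succ := fun i j ↦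
    hS.antisymm_right _ _ _ _
  have e3 : ∀ i j : Fin 3, S i.succ 0 j.succ 0 = S 0 i.succ 0 j.succ := fun i j ↦ by
    rw [hS.antisymm_left, e2, neg_neg]
  have s0 : signEta 0 = -1 := rfl
  have s1 : ∀ i : Fin 3, signEta i.succ = 1 := fun i ↦ if_neg (Fin.succ_ne_zero i)
  constructor <;>
  · simp only [Fin.sum_univ_succ (n := 3), hl, hr, h0, h1, h2, h3, e1, e2, e3, s0, s1,
      Finset.sum_add_distrib]
    simp only [Finset.sum_const_zero, neg_sq, mul_one, one_mul, mul_neg, neg_neg,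
      ne_eq, OfNat.ofNat_ne_zero, not_false_eq_true, zero_pow, mul_zero, add_zero, zero_add]
    ring

lemma abs_le_sqrt_sum_sq (S : Fin 4 → Fin 4 → Fin 4 → Fin 4 → ℝ) (a b c d : Fin 4) :
    |S a b c d| ≤ √(∑ a, ∑ b, ∑ c, ∑ d, S a b c d ^ 2) := by
  apply Real.abs_le_sqrt
  have h := Finset.single_le_sum (s := (Finset.univ : Finset (Fin 4 × Fin 4 × Fin 4 × Fin 4)))
    (f := fun i ↦ S i.1 i.2.1 i.2.2.1 i.2.2.2 ^ 2) (fun i _ ↦ sq_nonneg _)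
    (Finset.mem_univ (a, b, c, d))
  simpa only [Fintype.sum_prod_type] using h

lemma frameTensor_add (S T : Fin 4 → Fin 4 → Fin 4 → Fin 4 → ℝ) (E : Fin 4 → Fin 4 → ℝ)
    (a b c d : Fin 4) : frameTensor (fun μ ν α β ↦ S μ ν α β + T μ ν α β) E a b c d =
      frameTensor S E a b c d + frameTensor T E a b c d := by
  simp only [frameTensor, add_mul, Finset.sum_add_distrib]

lemma frameTensor_sub (S T : Fin 4 → Fin 4 → Fin 4 → Fin 4 → ℝ) (E : Fin 4 → Fin 4 → ℝ)
    (a b c d : Fin 4) : frameTensor (fun μ ν α β ↦ S μ ν α β - T μ ν α β) E a b c d =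
      frameTensor S E a b c d - frameTensor T E a b c d := by
  simp only [frameTensor, sub_mul, Finset.sum_sub_distrib]

lemma frameTensor_const_mul (r : ℝ) (T : Fin 4 → Fin 4 → Fin 4 → Fin 4 → ℝ)
    (E : Fin 4 → Fin 4 → ℝ) (a b c d : Fin 4) :
    frameTensor (fun μ ν α β ↦ r * T μ ν α β) E a b c d = r * frameTensor T E a b c d := by
  simp only [frameTensor, Finset.mul_sum, mul_assoc]

lemma frameTensor_mul_frameForm (A B : Fin 4 → Fin 4 → ℝ) (E : Fin 4 → Fin 4 → ℝ)
    (a b c d : Fin 4) :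
    frameTensor (fun μ ν α β ↦ A μ α * B ν β) E a b c d =
      frameForm A E a c * frameForm B E b d := by
  unfold frameTensor frameForm
  simp only [Finset.sum_mul_sum]
  refine Finset.sum_congr rfl fun μ _ ↦ ?_
  refine (Finset.sum_congr rfl fun ν _ ↦ Finset.sum_congr rfl fun α _ ↦
      Finset.sum_congr rfl fun β _ ↦ ?_)
  ring

lemma frameTensor_swap (T : Fin 4 → Fin 4 → Fin 4 → Fin 4 → ℝ) (E : Fin 4 → Fin 4 → ℝ)
    (a b c d : Fin 4) :
    frameTensor (fun μ ν α β ↦ T μ ν β α) E a b c d = frameTensor T E a b d c := by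
  unfold frameTensor
  refine Finset.sum_congr rfl fun μ _ ↦ Finset.sum_congr rfl fun ν _ ↦ ?_
  rw [Finset.sum_comm]
  exact Finset.sum_congr rfl fun α _ ↦ Finset.sum_congr rfl fun β _ ↦ by ring

/-! ### Partial derivatives -/

lemma pd_congr {f h : CoordSpace → ℝ} {x : CoordSpace} (H : f =ᶠ[𝓝 x] h) (μ : Fin 4) :
    pd μ f x = pd μ h x := by
  rw [pd, pd, H.fderiv_eq]

lemma pd_add {f h : CoordSpace → ℝ} {x : CoordSpace} (hf : DifferentiableAt ℝ f x)
    (hh : DifferentiableAt ℝ h x) (μ : Fin 4) :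
    pd μ (fun y ↦ f y + h y) x = pd μ f x + pd μ h x := by
  simp [pd, fderiv_fun_add hf hh]

lemma pd_sub {f h : CoordSpace → ℝ} {x : CoordSpace} (hf : DifferentiableAt ℝ f x)
    (hh : DifferentiableAt ℝ h x) (μ : Fin 4) :
    pd μ (fun y ↦ f y - h y) x = pd μ f x - pd μ h x := by
  simp [pd, fderiv_fun_sub hf hh]

lemma pd_mul {f h : CoordSpace → ℝ} {x : CoordSpace} (hf : DifferentiableAt ℝ f x)
    (hh : DifferentiableAt ℝ h x) (μ : Fin 4) :
    pd μ (fun y ↦ f y * h y) x = pd μ f x * h x + f x * pd μ h x := by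
  simp [pd, fderiv_fun_mul hf hh]; ring

lemma pd_const_mul {f : CoordSpace → ℝ} {x : CoordSpace} (hf : DifferentiableAt ℝ f x) (r : ℝ)
    (μ : Fin 4) : pd μ (fun y ↦ r * f y) x = r * pd μ f x := by
  simp [pd, fderiv_const_mul hf]

lemma pd_sum {f : Fin 4 → CoordSpace → ℝ} {x : CoordSpace}
    (hf : ∀ σ, DifferentiableAt ℝ (f σ) x) (μ : Fin 4) :
    pd μ (fun y ↦ ∑ σ, f σ y) x = ∑ σ, pd μ (f σ) x := by
  simp [pd, fderiv_fun_sum fun σ _ ↦ hf σ]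

lemma ContDiffAt.pd {f : CoordSpace → ℝ} {x : CoordSpace} (hf : ContDiffAt ℝ ∞ f x) (μ : Fin 4) :
    ContDiffAt ℝ ∞ (pd μ f) x :=
  (hf.fderiv_right (m := ∞) le_rfl).clm_apply contDiffAt_const

lemma ContDiffAt.differentiableAt_infty {f : CoordSpace → ℝ} {x : CoordSpace}
    (hf : ContDiffAt ℝ ∞ f x) : DifferentiableAt ℝ f x :=
  hf.differentiableAt (by simp)

lemma pd_pd_comm {f : CoordSpace → ℝ} {x : CoordSpace} (hf : ContDiffAt ℝ ∞ f x) (μ ν : Fin 4) :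
    pd μ (pd ν f) x = pd ν (pd μ f) x := by
  have h1 : DifferentiableAt ℝ (fderiv ℝ f) x :=
    (hf.fderiv_right (m := ∞) le_rfl).differentiableAt (by simp)
  have h2 : IsSymmSndFDerivAt ℝ f x := hf.isSymmSndFDerivAt (by simp; exact WithTop.coe_le_coe.mpr le_top)
  have h3 : ∀ α β : Fin 4, pd α (pd β f) x =
      fderiv ℝ (fderiv ℝ f) x (EuclideanSpace.single α (1 : ℝ)) (EuclideanSpace.single β (1 : ℝ)) := by
    intro α β
    have h4 := (h1.hasFDerivAt.clm_apply
      (hasFDerivAt_const (EuclideanSpace.single β (1 : ℝ) : CoordSpace) x)).fderiv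
    change fderiv ℝ (fun y ↦ fderiv ℝ f y (EuclideanSpace.single β (1 : ℝ))) x _ = _
    rw [h4]
    simp
  rw [h3, h3, h2]

lemma contDiffAt_matrix_det {G : CoordSpace → Matrix (Fin 4) (Fin 4) ℝ} {x : CoordSpace}
    (hG : ∀ i j, ContDiffAt ℝ ∞ (fun y ↦ G y i j) x) : ContDiffAt ℝ ∞ (fun y ↦ (G y).det) x := by
  simp only [Matrix.det_apply]
  refine ContDiffAt.sum fun s _ ↦ ?_
  exact (contDiffAt_prod fun i _ ↦ hG _ _).const_smul _

lemma contDiffAt_matrix_inv {G : CoordSpace → Matrix (Fin 4) (Fin 4) ℝ} {x : CoordSpace}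
    (hG : ∀ i j, ContDiffAt ℝ ∞ (fun y ↦ G y i j) x) (hx : (G x).det ≠ 0) (i j : Fin 4) :
    ContDiffAt ℝ ∞ (fun y ↦ (G y)⁻¹ i j) x := by
  simp only [Matrix.inv_def, Ring.inverse_eq_inv', Matrix.smul_apply, smul_eq_mul,
    Matrix.adjugate_apply]
  refine ((contDiffAt_matrix_det hG).inv hx).mul (contDiffAt_matrix_det fun k l ↦ ?_)
  -- the cofactor matrix has the `j`-th row replaced by a constant unit vector
  by_cases hk : k = j
  · subst hk; simpa using contDiffAt_const
  · simpa [Matrix.updateRow_ne hk] using hG k l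

/-! ### Metric and vector fields in coordinates -/

section
variable {M : Type*} [TopologicalSpace M] [ChartedSpace CoordSpace M] [IsManifold (𝓡 4) ∞ M]
  {φ : OpenPartialHomeomorph M CoordSpace}

lemma contMDiffAt_coordVec (hφ : φ ∈ IsManifold.maximalAtlas (𝓡 4) ∞ M) {x : CoordSpace}
    (hx : x ∈ φ.target) (μ : Fin 4) :
    ContMDiffAt (𝓡 4) (𝓡 4).tangent ∞
      (fun y ↦ (⟨φ.symm y, coordVec φ μ y⟩ : TangentBundle (𝓡 4) M)) x := by
  have h1 := contMDiffOn_symm_of_mem_maximalAtlas hφ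
  have h2 := h1.contMDiffOn_tangentMapWithin (m := ∞) le_rfl φ.open_target.uniqueMDiffOn
  have h3 : ContMDiff (𝓡 4) (𝓡 4).tangent ∞ (fun y : CoordSpace ↦
      (⟨y, (EuclideanSpace.single μ (1 : ℝ) : CoordSpace)⟩ : TangentBundle (𝓡 4) CoordSpace)) :=
    contMDiff_vectorSpace_iff_contDiff.mpr contDiff_const
  have h4 := (h2.comp h3.contMDiffOn (s := φ.target) (fun y hy ↦ hy))
  refine ((h4 x hx).contMDiffAt (φ.open_target.mem_nhds hx)).congr_of_eventuallyEq ?_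
  filter_upwards [φ.open_target.mem_nhds hx] with y hy
  simp [tangentMapWithin, coordVec, mfderivWithin_of_isOpen φ.open_target hy]

lemma LorentzianMetric.contDiffAt_lower (g : LorentzianMetric M)
    (hφ : φ ∈ IsManifold.maximalAtlas (𝓡 4) ∞ M) {x : CoordSpace}
    (hx : x ∈ φ.target) (μ ν : Fin 4) : ContDiffAt ℝ ∞ (fun y ↦ g.lower φ y μ ν) x := by
  have h1 := contMDiffAt_coordVec hφ hx μ
  have h2 := contMDiffAt_coordVec hφ hx ν
  have h0 : ContMDiffAt (𝓡 4) ((𝓡 4).prod 𝓘(ℝ, CoordSpace →L[ℝ] CoordSpace →L[ℝ] ℝ)) ∞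
    (fun y ↦ (⟨φ.symm y, g.form (φ.symm y)⟩ :
        Bundle.TotalSpace (CoordSpace →L[ℝ] CoordSpace →L[ℝ] ℝ)
          (fun p : M ↦ TangentSpace (𝓡 4) p →L[ℝ] TangentSpace (𝓡 4) p →L[ℝ] ℝ))) x :=
    g.smooth.contMDiffAt.comp x
      ((contMDiffOn_symm_of_mem_maximalAtlas hφ).contMDiffAt (φ.open_target.mem_nhds hx))
  have h3 : ContMDiffAt (𝓡 4) ((𝓡 4).prod 𝓘(ℝ, ℝ)) ∞
      (fun y ↦ Bundle.TotalSpace.mk' ℝ (E := Bundle.Trivial M ℝ) (φ.symm y)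
        (g.form (φ.symm y) (coordVec φ μ y) (coordVec φ ν y))) x :=
    ContMDiffAt.clm_bundle_apply₂ (F₁ := CoordSpace) (F₂ := CoordSpace) h0 h1 h2
  rw [Bundle.contMDiffAt_totalSpace] at h3
  exact h3.2.contDiffAt

lemma contDiffAt_fieldComp {ξ : ∀ p : M, TangentSpace (𝓡 4) p}
    (hξ : ContMDiff (𝓡 4) (𝓡 4).tangent ∞ (fun p ↦ (⟨p, ξ p⟩ : TangentBundle (𝓡 4) M)))
    (hφ : φ ∈ IsManifold.maximalAtlas (𝓡 4) ∞ M) {x : CoordSpace}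
    (hx : x ∈ φ.target) (μ : Fin 4) : ContDiffAt ℝ ∞ (fieldComp φ ξ μ) x := by
  have h1 := contMDiffOn_of_mem_maximalAtlas hφ
  have h2 := h1.contMDiffOn_tangentMapWithin (m := ∞) le_rfl φ.open_source.uniqueMDiffOn
  have h3 := hξ.comp_contMDiffOn (contMDiffOn_symm_of_mem_maximalAtlas hφ)
  have h4 := (h2.comp h3 (s := φ.target) (fun y hy ↦ φ.map_target hy))
  have h5 := (contMDiff_snd_tangentBundle_modelSpace CoordSpace (𝓡 4)).comp_contMDiffOn h4
  have h6 := ((h5 x hx).contMDiffAt (φ.open_target.mem_nhds hx)).contDiffAt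
  have h7 : ContDiffAt ℝ ∞
      (fun y ↦ (mfderiv (𝓡 4) (𝓡 4) φ (φ.symm y) (ξ (φ.symm y)) : CoordSpace)) x := by
    refine h6.congr_of_eventuallyEq ?_
    filter_upwards [φ.open_target.mem_nhds hx] with y hy
    have h8 := mfderivWithin_of_isOpen (I := 𝓡 4) (I' := 𝓡 4) (f := φ) φ.open_source
      (φ.map_target hy)
    exact congrArg (fun L : CoordSpace →L[ℝ] CoordSpace ↦ L (ξ (φ.symm y))) h8.symm
  exact (EuclideanSpace.proj (𝕜 := ℝ) μ).contDiff.contDiffAt.comp x h7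

/-- The derivative of a chart at `p`, with values in the coordinate space. -/
noncomputable def chartDeriv (φ : OpenPartialHomeomorph M CoordSpace) (p : M) :
    TangentSpace (𝓡 4) p →L[ℝ] CoordSpace :=
  mfderiv (𝓡 4) (𝓡 4) φ p

/-- The derivative of the inverse of a chart at `x`, as a map on the coordinate space. -/
noncomputable def symmDeriv (φ : OpenPartialHomeomorph M CoordSpace) (x : CoordSpace) :
    CoordSpace →L[ℝ] TangentSpace (𝓡 4) (φ.symm x) :=
  mfderiv (𝓡 4) (𝓡 4) φ.symm x

omit [IsManifold (𝓡 4) ∞ M] in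
lemma vecComp_eq_chartDeriv (p : M) (v : TangentSpace (𝓡 4) p) (μ : Fin 4) :
    vecComp φ p v μ = chartDeriv φ p v μ := rfl

omit [IsManifold (𝓡 4) ∞ M] in
/-- The derivative of `φ.symm` at `x` is the inverse of that of `φ` at `φ.symm x`. -/
lemma chartDeriv_symmDeriv (hφ : φ ∈ IsManifold.maximalAtlas (𝓡 4) ∞ M) {x : CoordSpace}
    (hx : x ∈ φ.target) (w : CoordSpace) : chartDeriv φ (φ.symm x) (symmDeriv φ x w) = w := by
  have h1 : MDifferentiableAt (𝓡 4) (𝓡 4) φ (φ.symm x) :=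
    ((contMDiffOn_of_mem_maximalAtlas hφ).contMDiffAt
      (φ.open_source.mem_nhds (φ.map_target hx))).mdifferentiableAt (by simp)
  have h2 : MDifferentiableAt (𝓡 4) (𝓡 4) φ.symm x :=
    ((contMDiffOn_symm_of_mem_maximalAtlas hφ).contMDiffAt
      (φ.open_target.mem_nhds hx)).mdifferentiableAt (by simp)
  have h3 := h1.hasMFDerivAt.comp x h2.hasMFDerivAt
  have h4 : φ ∘ φ.symm =ᶠ[𝓝 x] id := by
    filter_upwards [φ.open_target.mem_nhds hx] with q hq using φ.right_inv hq
  have h5 := hasMFDerivAt_unique h3 ((hasMFDerivAt_id x).congr_of_eventuallyEq h4)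
  exact congrArg (fun L : CoordSpace →L[ℝ] CoordSpace ↦ L w) h5

omit [IsManifold (𝓡 4) ∞ M] in
lemma symmDeriv_chartDeriv (hφ : φ ∈ IsManifold.maximalAtlas (𝓡 4) ∞ M) {x : CoordSpace}
    (hx : x ∈ φ.target) (v : TangentSpace (𝓡 4) (φ.symm x)) :
    symmDeriv φ x (chartDeriv φ (φ.symm x) v) = v := by
  have h : ∀ A B : CoordSpace →ₗ[ℝ] CoordSpace, (∀ w, A (B w) = w) → ∀ w, B (A w) = w := by
    intro A B hAB w
    have h1 : A ∘ₗ B = LinearMap.id := LinearMap.ext hAB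
    exact LinearMap.congr_fun (mul_eq_one_comm.mp h1 : B * A = 1) w
  exact h (chartDeriv φ (φ.symm x)).toLinearMap (symmDeriv φ x).toLinearMap
    (chartDeriv_symmDeriv hφ hx) v

lemma coordSpace_eq_sum (w : CoordSpace) :
    w = ∑ μ, w μ • (EuclideanSpace.single μ (1 : ℝ) : CoordSpace) := by
  have := (EuclideanSpace.basisFun (Fin 4) ℝ).sum_repr w
  simpa using this.symm

omit [IsManifold (𝓡 4) ∞ M] in
/-- A tangent vector is the combination of the coordinate vectors with its components. -/
lemma sum_vecComp_smul_coordVec (hφ : φ ∈ IsManifold.maximalAtlas (𝓡 4) ∞ M) {x : CoordSpace}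
    (hx : x ∈ φ.target) (v : TangentSpace (𝓡 4) (φ.symm x)) :
    ∑ μ, vecComp φ (φ.symm x) v μ • coordVec φ μ x = v := by
  conv_rhs => rw [← symmDeriv_chartDeriv hφ hx v, coordSpace_eq_sum (chartDeriv φ (φ.symm x) v),
    map_sum]
  refine Finset.sum_congr rfl fun μ _ ↦ ?_
  rw [map_smul]
  rfl

lemma LorentzianMetric.form_eq_sum (g : LorentzianMetric M)
    (hφ : φ ∈ IsManifold.maximalAtlas (𝓡 4) ∞ M) {x : CoordSpace} (hx : x ∈ φ.target)
    (u v : TangentSpace (𝓡 4) (φ.symm x)) :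
    g.form (φ.symm x) u v = ∑ μ, ∑ ν, g.lower φ x μ ν *
      (vecComp φ (φ.symm x) u μ * vecComp φ (φ.symm x) v ν) := by
  conv_lhs => rw [← sum_vecComp_smul_coordVec hφ hx u, ← sum_vecComp_smul_coordVec hφ hx v]
  simp only [map_sum, sum_apply, map_smul, smul_apply, smul_eq_mul, Finset.mul_sum]
  rw [Finset.sum_comm]
  refine Finset.sum_congr rfl fun μ _ ↦ Finset.sum_congr rfl fun ν _ ↦ ?_
  simp only [LorentzianMetric.lower, Matrix.of_apply]
  ring

lemma LorentzianMetric.det_lower_ne_zero (g : LorentzianMetric M)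
    (hφ : φ ∈ IsManifold.maximalAtlas (𝓡 4) ∞ M) {x : CoordSpace} (hx : x ∈ φ.target) :
    (g.lower φ x).det ≠ 0 := by
  obtain ⟨b, hb⟩ := g.signature (φ.symm x)
  refine (inv_eq_of_frameForm (E := fun a ↦ vecComp φ (φ.symm x) (b a)) fun a c ↦ ?_).1.ne_zero
  rw [← hb, g.form_eq_sum hφ hx]
  rfl

/-- In coordinates, the covector field of a hypersurface-orthogonal `ξ` is locally `f dτ`: a
covector that vanishes on the kernel of `dτ` is a multiple of `dτ`, and the factor, a quotient of
components, is smooth. -/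
lemma LorentzianMetric.exists_eq_mul_pd (g : LorentzianMetric M)
    {ξ : ∀ p : M, TangentSpace (𝓡 4) p} (hξ : g.IsStaticKilling ξ)
    (hφ : φ ∈ IsManifold.maximalAtlas (𝓡 4) ∞ M) {x : CoordSpace} (hx : x ∈ φ.target)
    (hp : φ.symm x ∈ g.timelikeRegion ξ) :
    ∃ f τ : CoordSpace → ℝ, ∀ᶠ y in 𝓝 x, ContDiffAt ℝ ∞ f y ∧ ContDiffAt ℝ ∞ τ y ∧
      ∀ μ, ∑ ν, g.lower φ y μ ν * fieldComp φ ξ ν y = f y * pd μ τ y := by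
  obtain ⟨U, t, hU, hpU, ht, hort⟩ := hξ.hypersurfaceOrthogonal _ hp
  have hcont : ContinuousAt φ.symm x := φ.symm.continuousAt hx
  have hsymm : ∀ y ∈ φ.target, ContMDiffAt (𝓡 4) (𝓡 4) ∞ φ.symm y := fun y hy ↦
    (contMDiffOn_symm_of_mem_maximalAtlas hφ).contMDiffAt (φ.open_target.mem_nhds hy)
  have htau : ∀ y ∈ φ.target, φ.symm y ∈ U → ContDiffAt ℝ ∞ (t ∘ φ.symm) y := fun y hy hyU ↦
    ((ht.contMDiffAt (hU.mem_nhds hyU)).comp y (hsymm y hy)).contDiffAt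
  -- the differential of `t` in coordinates
  have hd : ∀ y ∈ φ.target, φ.symm y ∈ U → ∀ w : CoordSpace,
      (mfderiv (𝓡 4) 𝓘(ℝ, ℝ) t (φ.symm y) (symmDeriv φ y w) : ℝ) =
        ∑ μ, w μ * pd μ (t ∘ φ.symm) y := by
    intro y hy hyU w
    have h1 := ((ht.contMDiffAt (hU.mem_nhds hyU)).mdifferentiableAt (by simp)).hasMFDerivAt.comp y
      ((hsymm y hy).mdifferentiableAt (by simp)).hasMFDerivAt
    have h2 : fderiv ℝ (t ∘ φ.symm) y w =
        (mfderiv (𝓡 4) 𝓘(ℝ, ℝ) t (φ.symm y) (symmDeriv φ y w) : ℝ) := by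
      rw [← mfderiv_eq_fderiv]
      exact congrArg (fun L : CoordSpace →L[ℝ] ℝ ↦ L w) h1.mfderiv
    rw [← h2]
    conv_lhs => rw [coordSpace_eq_sum w]
    simp only [map_sum, map_smul, smul_eq_mul]
    rfl
  have hξlow : ∀ y ∈ φ.target, ∀ w : CoordSpace,
      g.form (φ.symm y) (ξ (φ.symm y)) (symmDeriv φ y w) =
        ∑ μ, w μ * ∑ ν, g.lower φ y μ ν * fieldComp φ ξ ν y := by
    intro y hy w
    rw [g.form_eq_sum hφ hy, Finset.sum_comm]
    refine Finset.sum_congr rfl fun μ _ ↦ ?_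
    rw [Finset.mul_sum]
    refine Finset.sum_congr rfl fun ν _ ↦ ?_
    have h2 : vecComp φ (φ.symm y) (symmDeriv φ y w) μ = w μ :=
      congrArg (fun w : CoordSpace ↦ w μ) (chartDeriv_symmDeriv hφ hy w)
    rw [h2, show g.lower φ y ν μ = g.lower φ y μ ν from g.symm _ _ _, fieldComp]
    ring
  have hdne : ∃ m, pd m (t ∘ φ.symm) x ≠ 0 := by
    by_contra! h0
    refine (hort _ hpU).1 ?_
    ext v
    have h1 := hd x hx hpU (chartDeriv φ (φ.symm x) v)
    simp only [h0, mul_zero, Finset.sum_const_zero] at h1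
    rw [symmDeriv_chartDeriv hφ hx v] at h1
    exact h1
  obtain ⟨m, hm⟩ := hdne
  have hlow : ∀ y ∈ φ.target,
      ContDiffAt ℝ ∞ (fun y ↦ ∑ ν, g.lower φ y m ν * fieldComp φ ξ ν y) y := fun y hy ↦
    ContDiffAt.sum fun ν _ ↦ (g.contDiffAt_lower hφ hy m ν).mul
      (contDiffAt_fieldComp hξ.smooth hφ hy ν)
  refine ⟨fun y ↦ (∑ ν, g.lower φ y m ν * fieldComp φ ξ ν y) / pd m (t ∘ φ.symm) y, t ∘ φ.symm, ?_⟩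
  filter_upwards [φ.open_target.mem_nhds hx, hcont (hU.mem_nhds hpU),
    ((htau x hx hpU).pd m).continuousAt.eventually_ne hm] with y hy hyU hym
  refine ⟨(hlow y hy).div ((htau y hy hyU).pd m) hym, htau y hy hyU, fun μ ↦ ?_⟩
  -- this vector is annihilated by `dt`, hence is orthogonal to `ξ`
  set w : CoordSpace := pd m (t ∘ φ.symm) y • EuclideanSpace.single μ (1 : ℝ) -
    pd μ (t ∘ φ.symm) y • EuclideanSpace.single m (1 : ℝ) with hw
  have hsum : ∀ F : Fin 4 → ℝ, ∑ κ, w κ * F κ =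
      pd m (t ∘ φ.symm) y * F μ - pd μ (t ∘ φ.symm) y * F m := by
    intro F
    simp [hw, sub_mul, Finset.sum_sub_distrib]
  have h3 := (hort _ hyU).2 (symmDeriv φ y w) (by
    refine (hd y hy hyU w).trans ((hsum _).trans ?_)
    exact sub_eq_zero.mpr (mul_comm (pd m (t ∘ φ.symm) y) (pd μ (t ∘ φ.symm) y)))
  rw [hξlow y hy, hsum] at h3
  rw [div_mul_eq_mul_div, eq_div_iff hym]
  linarith
end

/-! ### Symmetries of the curvature in coordinates -/

noncomputable section
namespace LorentzianMetric

variable {M : Type*} [TopologicalSpace M] [ChartedSpace CoordSpace M] [IsManifold (𝓡 4) ∞ M]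
  (g : LorentzianMetric M) (φ : OpenPartialHomeomorph M CoordSpace)

/-- The Christoffel symbols of the first kind, `Γ_{μαβ} = g_{μσ} Γ^σ_{αβ}`. -/
def christoffelFirst (μ α β : Fin 4) (x : CoordSpace) : ℝ :=
  (1 / 2) * (pd α (fun y ↦ g.lower φ y μ β) x + pd β (fun y ↦ g.lower φ y μ α) x
      - pd μ (fun y ↦ g.lower φ y α β) x)

lemma lower_symm (x : CoordSpace) (μ ν : Fin 4) : g.lower φ x μ ν = g.lower φ x ν μ :=
  g.symm _ _ _

lemma upper_symm (x : CoordSpace) (μ ν : Fin 4) : g.upper φ x μ ν = g.upper φ x ν μ := by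
  have h : (g.lower φ x).transpose = g.lower φ x := Matrix.ext fun i j ↦ g.lower_symm φ x j i
  have h1 : (g.upper φ x).transpose = g.upper φ x := by
    rw [upper, Matrix.transpose_nonsing_inv, h]
  exact congrFun (congrFun h1 ν) μ

lemma christoffelFirst_symm (μ α β : Fin 4) (x : CoordSpace) :
    g.christoffelFirst φ μ α β x = g.christoffelFirst φ μ β α x := by
  simp only [christoffelFirst, g.lower_symm φ _ α β]; ring

lemma christoffel_symm (μ α β : Fin 4) (x : CoordSpace) :
    g.christoffel φ μ α β x = g.christoffel φ μ β α x := by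
  simp only [christoffel]
  congr 1
  refine Finset.sum_congr rfl fun ν _ ↦ ?_
  simp only [g.lower_symm φ _ α β]; ring

lemma pd_lower_eq (μ ν α : Fin 4) (x : CoordSpace) :
    pd α (fun y ↦ g.lower φ y μ ν) x =
      g.christoffelFirst φ μ ν α x + g.christoffelFirst φ ν μ α x := by
  simp only [christoffelFirst, g.lower_symm φ _ ν μ]
  ring

lemma riemann_antisymm_right (x : CoordSpace) (μ ν α β : Fin 4) :
    g.riemann φ x μ ν α β = -g.riemann φ x μ ν β α := by
  simp only [riemann, riemannMixed, ← Finset.sum_neg_distrib]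
  refine Finset.sum_congr rfl fun σ _ ↦ ?_
  rw [← mul_neg]
  congr 1
  rw [neg_add, ← Finset.sum_neg_distrib]
  simp only [neg_sub]

variable {φ} {x : CoordSpace}

section
variable (hφ : φ ∈ IsManifold.maximalAtlas (𝓡 4) ∞ M) (hx : x ∈ φ.target)
include hφ hx

lemma contDiffAt_upper (μ ν : Fin 4) : ContDiffAt ℝ ∞ (fun y ↦ g.upper φ y μ ν) x :=
  contDiffAt_matrix_inv (fun i j ↦ g.contDiffAt_lower hφ hx i j)
    (g.det_lower_ne_zero hφ hx) μ ν

lemma contDiffAt_christoffel (μ α β : Fin 4) : ContDiffAt ℝ ∞ (g.christoffel φ μ α β) x :=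
  contDiffAt_const.mul (ContDiffAt.sum fun ν _ ↦ (g.contDiffAt_upper hφ hx μ ν).mul
    ((((g.contDiffAt_lower hφ hx _ _).pd _).add
    ((g.contDiffAt_lower hφ hx _ _).pd _)).sub ((g.contDiffAt_lower hφ hx _ _).pd _)))

lemma sum_lower_mul_upper (v : Fin 4 → ℝ) (μ : Fin 4) :
    ∑ σ, g.lower φ x μ σ * ∑ ν, g.upper φ x σ ν * v ν = v μ := by
  have h := Matrix.mulVec_mulVec v (g.lower φ x) (g.upper φ x)
  rw [upper, Matrix.mul_nonsing_inv _ (g.det_lower_ne_zero hφ hx).isUnit, Matrix.one_mulVec] at h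
  exact congrFun h μ

lemma sum_lower_mul_christoffel (μ α β : Fin 4) :
    ∑ σ, g.lower φ x μ σ * g.christoffel φ σ α β x = g.christoffelFirst φ μ α β x := by
  simp only [christoffel, mul_left_comm _ (1 / 2 : ℝ), ← Finset.mul_sum]
  rw [g.sum_lower_mul_upper hφ hx (fun ν ↦ pd α (fun y ↦ g.lower φ y ν β) x +
    pd β (fun y ↦ g.lower φ y ν α) x - pd ν (fun y ↦ g.lower φ y α β) x), christoffelFirst]

lemma sum_christoffelFirst_mul_christoffel_comm (μ α ν β : Fin 4) :
    ∑ σ, g.christoffelFirst φ σ μ α x * g.christoffel φ σ ν β x =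
      ∑ σ, g.christoffelFirst φ σ ν β x * g.christoffel φ σ μ α x := by
  simp only [← g.sum_lower_mul_christoffel hφ hx, Finset.sum_mul]
  rw [Finset.sum_comm]
  refine Finset.sum_congr rfl fun σ _ ↦ Finset.sum_congr rfl fun ρ _ ↦ ?_
  rw [g.lower_symm φ x ρ σ]; ring

lemma pd_christoffelFirst_eq_sum (μ ν α β : Fin 4) :
    pd α (g.christoffelFirst φ μ ν β) x =
      ∑ σ, (g.christoffelFirst φ μ σ α x * g.christoffel φ σ ν β x
        + g.christoffelFirst φ σ μ α x * g.christoffel φ σ ν β x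
        + g.lower φ x μ σ * pd α (g.christoffel φ σ ν β) x) := by
  have h1 : g.christoffelFirst φ μ ν β =ᶠ[𝓝 x]
      fun y ↦ ∑ σ, g.lower φ y μ σ * g.christoffel φ σ ν β y := by
    filter_upwards [φ.open_target.mem_nhds hx] with y hy
    exact (g.sum_lower_mul_christoffel hφ hy μ ν β).symm
  have h2 := fun σ ↦ (g.contDiffAt_lower hφ hx μ σ).differentiableAt_infty
  have h3 := fun σ ↦ (g.contDiffAt_christoffel hφ hx σ ν β).differentiableAt_infty
  rw [pd_congr h1, pd_sum fun σ ↦ (h2 σ).fun_mul (h3 σ)]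
  refine Finset.sum_congr rfl fun σ _ ↦ ?_
  rw [pd_mul (h2 σ) (h3 σ), g.pd_lower_eq φ]; ring

/-- The covariant Riemann tensor in terms of Christoffel symbols of the first kind: lowering the
index inside the derivatives changes the sign of the quadratic terms. -/
lemma riemann_eq (μ ν α β : Fin 4) :
    g.riemann φ x μ ν α β =
      pd α (g.christoffelFirst φ μ ν β) x - pd β (g.christoffelFirst φ μ ν α) x
      - ∑ σ, g.christoffelFirst φ σ μ α x * g.christoffel φ σ ν β x
      + ∑ σ, g.christoffelFirst φ σ μ β x * g.christoffel φ σ ν α x := by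
  have h1 : ∀ α β : Fin 4, ∑ σ, g.lower φ x μ σ *
      ∑ ρ, g.christoffel φ σ ρ α x * g.christoffel φ ρ ν β x =
      ∑ ρ, g.christoffelFirst φ μ ρ α x * g.christoffel φ ρ ν β x := by
    intro α β
    simp only [← g.sum_lower_mul_christoffel hφ hx μ, Finset.mul_sum, Finset.sum_mul]
    rw [Finset.sum_comm]
    simp only [mul_assoc]
  rw [g.pd_christoffelFirst_eq_sum hφ hx, g.pd_christoffelFirst_eq_sum hφ hx]
  simp only [riemann, riemannMixed, mul_add, mul_sub, Finset.sum_add_distrib,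
    Finset.sum_sub_distrib, h1]
  ring

lemma pd_christoffelFirst (μ ν α β : Fin 4) :
    pd α (g.christoffelFirst φ μ ν β) x = (1 / 2) *
      (pd α (pd ν fun y ↦ g.lower φ y μ β) x + pd α (pd β fun y ↦ g.lower φ y μ ν) x
        - pd α (pd μ fun y ↦ g.lower φ y ν β) x) := by
  have h := fun μ ν κ ↦ ((g.contDiffAt_lower hφ hx μ ν).pd κ).differentiableAt_infty
  unfold christoffelFirst
  rw [pd_const_mul (((h _ _ _).fun_add (h _ _ _)).fun_sub (h _ _ _)),
    pd_sub ((h _ _ _).fun_add (h _ _ _)) (h _ _ _), pd_add (h _ _ _) (h _ _ _)]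

lemma riemann_isCurvatureLike : IsCurvatureLike (g.riemann φ x) := by
  have hc := fun μ ν κ l ↦ pd_pd_comm (g.contDiffAt_lower hφ hx μ ν) κ l
  have hs : ∀ μ ν, (fun y ↦ g.lower φ y μ ν) = fun y ↦ g.lower φ y ν μ := fun μ ν ↦
    funext fun y ↦ g.lower_symm φ y μ ν
  refine ⟨fun μ ν α β ↦ ?_, g.riemann_antisymm_right φ x, fun μ ν α β ↦ ?_⟩
  · rw [g.riemann_eq hφ hx, g.riemann_eq hφ hx,
      g.sum_christoffelFirst_mul_christoffel_comm hφ hx μ α ν β,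
      g.sum_christoffelFirst_mul_christoffel_comm hφ hx μ β ν α]
    simp only [g.pd_christoffelFirst hφ hx]
    rw [hs ν μ, hc μ ν β α]
    ring
  · rw [g.riemann_eq hφ hx, g.riemann_eq hφ hx,
      g.sum_christoffelFirst_mul_christoffel_comm hφ hx μ β ν α]
    simp only [g.christoffelFirst_symm φ _ α, g.christoffel_symm φ _ β,
      g.pd_christoffelFirst hφ hx]
    rw [hs α ν, hs β ν, hs α μ, hs β μ, hc μ β α ν, hc ν β α μ, hc μ α β ν, hc ν α β μ, hc μ ν α β, hc α β μ ν]
    ring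

lemma ricci_eq (μ ν : Fin 4) :
    g.ricci φ x μ ν = ∑ σ, ∑ ρ, g.upper φ x σ ρ * g.riemann φ x ρ μ σ ν := by
  refine Finset.sum_congr rfl fun σ _ ↦ ?_
  have h := Matrix.mulVec_mulVec (fun ρ ↦ g.riemannMixed φ ρ μ σ ν x)
    (g.upper φ x) (g.lower φ x)
  rw [upper, Matrix.nonsing_inv_mul _ (g.det_lower_ne_zero hφ hx).isUnit, Matrix.one_mulVec] at h
  exact (congrFun h σ).symm

lemma ricci_symm (μ ν : Fin 4) : g.ricci φ x μ ν = g.ricci φ x ν μ := by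
  rw [g.ricci_eq hφ hx, g.ricci_eq hφ hx, Finset.sum_comm]
  refine Finset.sum_congr rfl fun σ _ ↦ Finset.sum_congr rfl fun ρ _ ↦ ?_
  rw [g.upper_symm φ x, (g.riemann_isCurvatureLike hφ hx).pair_symm]

lemma weyl_isCurvatureLike : IsCurvatureLike (g.weyl φ x) := by
  have hR := g.riemann_isCurvatureLike hφ hx
  refine ⟨fun μ ν α β ↦ ?_, fun μ ν α β ↦ ?_, fun μ ν α β ↦ ?_⟩
  · simp only [weyl]
    rw [hR.antisymm_left]; ring
  · simp only [weyl]
    rw [hR.antisymm_right]; ring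
  · simp only [weyl]
    rw [hR.pair_symm, g.lower_symm φ x α μ, g.lower_symm φ x β ν, g.lower_symm φ x β μ,
      g.lower_symm φ x α ν, g.ricci_symm hφ hx β ν, g.ricci_symm hφ hx β μ,
      g.ricci_symm hφ hx α ν, g.ricci_symm hφ hx α μ]
    ring

end
end LorentzianMetric
end

/-! ### The covariant derivatives of a static Killing field -/

noncomputable section
namespace LorentzianMetric

variable {M : Type*} [TopologicalSpace M] [ChartedSpace CoordSpace M] [IsManifold (𝓡 4) ∞ M]
  (g : LorentzianMetric M) (φ : OpenPartialHomeomorph M CoordSpace)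
  (ξ : ∀ p : M, TangentSpace (𝓡 4) p)

/-- The covariant components `ξ_μ = g_{μν} ξ^ν` of a vector field. -/
def fieldLow (μ : Fin 4) (x : CoordSpace) : ℝ := ∑ ν, g.lower φ x μ ν * fieldComp φ ξ ν x

/-- The covariant derivative `∇_μ ξ_ν`. -/
def nablaField (μ ν : Fin 4) (x : CoordSpace) : ℝ :=
  pd μ (g.fieldLow φ ξ ν) x - ∑ σ, g.christoffel φ σ μ ν x * g.fieldLow φ ξ σ x

variable {φ ξ} {x : CoordSpace} (hξ : g.IsStaticKilling ξ)
  (hφ : φ ∈ IsManifold.maximalAtlas (𝓡 4) ∞ M) (hx : x ∈ φ.target)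
include hξ hφ hx

lemma contDiffAt_fieldLow (μ : Fin 4) : ContDiffAt ℝ ∞ (g.fieldLow φ ξ μ) x :=
  ContDiffAt.sum fun ν _ ↦ (g.contDiffAt_lower hφ hx μ ν).mul
    (contDiffAt_fieldComp hξ.smooth hφ hx ν)

omit hξ in
lemma sum_christoffelFirst_mul_fieldComp (μ ν : Fin 4) :
    ∑ σ, g.christoffelFirst φ σ μ ν x * fieldComp φ ξ σ x =
      ∑ σ, g.christoffel φ σ μ ν x * g.fieldLow φ ξ σ x := by
  simp only [← g.sum_lower_mul_christoffel hφ hx, fieldLow, Finset.sum_mul, Finset.mul_sum]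
  rw [Finset.sum_comm]
  refine Finset.sum_congr rfl fun σ _ ↦ Finset.sum_congr rfl fun ρ _ ↦ ?_
  rw [g.lower_symm φ x ρ σ]; ring

/-- Killing's equation in the form `∇_μ ξ_ν + ∇_ν ξ_μ = 0`. -/
lemma nablaField_antisymm (μ ν : Fin 4) :
    g.nablaField φ ξ μ ν x = -g.nablaField φ ξ ν μ x := by
  have hk := hξ.killing φ hφ x hx μ ν
  have hpd : ∀ κ l, pd κ (g.fieldLow φ ξ l) x = ∑ α,
      (pd κ (fun y ↦ g.lower φ y l α) x * fieldComp φ ξ α x +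
        g.lower φ x l α * pd κ (fieldComp φ ξ α) x) := by
    intro κ l
    have h1 := fun α ↦ (g.contDiffAt_lower hφ hx l α).differentiableAt_infty
    have h2 := fun α ↦ (contDiffAt_fieldComp hξ.smooth hφ hx α).differentiableAt_infty
    unfold fieldLow
    rw [pd_sum fun α ↦ (h1 α).fun_mul (h2 α)]
    exact Finset.sum_congr rfl fun α _ ↦ pd_mul (h1 α) (h2 α) κ
  have h : pd μ (g.fieldLow φ ξ ν) x + pd ν (g.fieldLow φ ξ μ) x =
      2 * ∑ σ, g.christoffelFirst φ σ μ ν x * fieldComp φ ξ σ x := by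
    rw [hpd, hpd, ← Finset.sum_add_distrib, ← sub_eq_zero, ← hk, Finset.mul_sum,
      ← Finset.sum_sub_distrib]
    refine Finset.sum_congr rfl fun α _ ↦ ?_
    simp only [christoffelFirst]
    rw [g.lower_symm φ x α ν]
    simp only [g.lower_symm φ _ α]
    ring
  rw [g.sum_christoffelFirst_mul_fieldComp hφ hx] at h
  simp only [nablaField, g.christoffel_symm φ _ ν μ]
  linarith

/-- The Ricci identity `R^σ_{ναβ} ξ_σ = ∇_β ∇_α ξ_ν - ∇_α ∇_β ξ_ν`. The Christoffel terms in the
slots `α`, `β` cancel by symmetry. -/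
lemma sum_riemannMixed_mul_fieldLow (ν α β : Fin 4) :
    ∑ σ, g.riemannMixed φ σ ν α β x * g.fieldLow φ ξ σ x =
      pd β (g.nablaField φ ξ α ν) x - pd α (g.nablaField φ ξ β ν) x
        + ∑ σ, (g.christoffel φ σ α ν x * g.nablaField φ ξ β σ x
          - g.christoffel φ σ β ν x * g.nablaField φ ξ α σ x) := by
  have hL := fun μ ↦ g.contDiffAt_fieldLow hξ hφ hx μ
  have hpd : ∀ α β, pd α (g.nablaField φ ξ β ν) x = pd α (pd β (g.fieldLow φ ξ ν)) x -
      ∑ σ, (pd α (g.christoffel φ σ β ν) x * g.fieldLow φ ξ σ x +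
        g.christoffel φ σ β ν x * pd α (g.fieldLow φ ξ σ) x) := by
    intro α β
    have h1 := fun σ ↦ (g.contDiffAt_christoffel hφ hx σ β ν).differentiableAt_infty
    have h2 := fun σ ↦ (hL σ).differentiableAt_infty
    have h3 := fun σ ↦ (h1 σ).fun_mul (h2 σ)
    unfold nablaField
    rw [pd_sub ((hL ν).pd β).differentiableAt_infty (DifferentiableAt.fun_sum fun σ _ ↦ h3 σ),
      pd_sum h3]
    congr 1
    exact Finset.sum_congr rfl fun σ _ ↦ pd_mul (h1 σ) (h2 σ) α
  have hpL : ∀ α σ, pd α (g.fieldLow φ ξ σ) x = g.nablaField φ ξ α σ x +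
      ∑ ρ, g.christoffel φ ρ α σ x * g.fieldLow φ ξ ρ x := fun α σ ↦ by
    rw [nablaField]; ring
  have hq : ∀ α β, ∑ σ, (∑ ρ, g.christoffel φ σ ρ α x * g.christoffel φ ρ β ν x) *
      g.fieldLow φ ξ σ x =
      ∑ σ, g.christoffel φ σ β ν x * ∑ ρ, g.christoffel φ ρ α σ x * g.fieldLow φ ξ ρ x := by
    intro α β
    simp only [Finset.sum_mul, Finset.mul_sum]
    rw [Finset.sum_comm]
    refine Finset.sum_congr rfl fun σ _ ↦ Finset.sum_congr rfl fun ρ _ ↦ ?_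
    rw [g.christoffel_symm φ ρ σ α]; ring
  have hΓ : ∀ σ β, g.christoffel φ σ ν β = g.christoffel φ σ β ν := fun σ β ↦
    funext (g.christoffel_symm φ σ ν β)
  rw [hpd, hpd, pd_pd_comm (hL ν) β α]
  simp only [riemannMixed, add_mul, sub_mul, Finset.sum_add_distrib, Finset.sum_sub_distrib, hΓ,
    hq]
  simp only [hpL, mul_add, Finset.sum_add_distrib]
  ring

omit hξ hφ hx in
lemma sum_fieldComp_mul_riemann (ν α β : Fin 4) :
    ∑ μ, fieldComp φ ξ μ x * g.riemann φ x μ ν α β =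
      ∑ σ, g.riemannMixed φ σ ν α β x * g.fieldLow φ ξ σ x := by
  simp only [riemann, fieldLow, Finset.mul_sum]
  rw [Finset.sum_comm]
  refine Finset.sum_congr rfl fun σ _ ↦ Finset.sum_congr rfl fun ρ _ ↦ ?_
  rw [g.lower_symm φ x ρ σ]; ring

omit hξ in
lemma form_field_eq (v : TangentSpace (𝓡 4) (φ.symm x)) :
    g.form (φ.symm x) (ξ (φ.symm x)) v =
      ∑ μ, g.fieldLow φ ξ μ x * vecComp φ (φ.symm x) v μ := by
  rw [g.form_eq_sum hφ hx, Finset.sum_comm]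
  refine Finset.sum_congr rfl fun μ _ ↦ ?_
  rw [fieldLow, Finset.sum_mul]
  refine Finset.sum_congr rfl fun ν _ ↦ ?_
  rw [g.lower_symm φ x ν μ, fieldComp]; ring

/-- Where a static Killing field is timelike, `∇ξ = w ∧ ξ` for a covector `w`, and `R(ξ, ·, ·, ·)` is
of the form `V ∧ ξ` in its last two slots. Both follow from `ξ_μ = f ∂_μ τ`: Killing's equation
gives `∇_μ ξ_ν = (∂_μ f ∂_ν τ - ∂_ν f ∂_μ τ) / 2`, and the Ricci identity expresses the curvature by
the derivatives of this. -/
lemma exists_nablaField_eq_and_riemann_eq (hp : φ.symm x ∈ g.timelikeRegion ξ) :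
    (∃ w : Fin 4 → ℝ, ∀ μ ν, g.nablaField φ ξ μ ν x =
      w μ * g.fieldLow φ ξ ν x - w ν * g.fieldLow φ ξ μ x) ∧
    ∃ V : Fin 4 → Fin 4 → ℝ, ∀ ν α β, ∑ μ, fieldComp φ ξ μ x * g.riemann φ x μ ν α β =
      V α ν * g.fieldLow φ ξ β x - V β ν * g.fieldLow φ ξ α x := by
  obtain ⟨f, τ, hfτ⟩ := g.exists_eq_mul_pd hξ hφ hx hp
  obtain ⟨hf, hτ, hL⟩ := hfτ.self_of_nhds
  change ∀ μ, g.fieldLow φ ξ μ x = f x * pd μ τ x at hL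
  have hpdL : ∀ᶠ y in 𝓝 x, ∀ μ ν, pd μ (g.fieldLow φ ξ ν) y =
      pd μ f y * pd ν τ y + f y * pd μ (pd ν τ) y := by
    filter_upwards [eventually_eventually_nhds.mpr hfτ] with y hy μ ν
    obtain ⟨hfy, hτy, -⟩ := hy.self_of_nhds
    rw [← pd_mul hfy.differentiableAt_infty (hτy.pd ν).differentiableAt_infty]
    exact pd_congr (hy.mono fun z hz ↦ hz.2.2 ν) μ
  have hF : ∀ᶠ y in 𝓝 x, ∀ μ ν, g.nablaField φ ξ μ ν y =
      (1 / 2) * (pd μ f y * pd ν τ y - pd ν f y * pd μ τ y) := by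
    filter_upwards [hpdL, φ.open_target.mem_nhds hx, hfτ] with y hy hyt hfy μ ν
    have h1 := g.nablaField_antisymm hξ hφ hyt μ ν
    have h2 : g.nablaField φ ξ μ ν y - g.nablaField φ ξ ν μ y =
        pd μ (g.fieldLow φ ξ ν) y - pd ν (g.fieldLow φ ξ μ) y := by
      simp only [nablaField, g.christoffel_symm φ _ ν μ]; ring
    rw [hy, hy, pd_pd_comm hfy.2.1 ν μ] at h2
    linarith
  have hFx := hF.self_of_nhds
  have hf0 : f x ≠ 0 := by
    intro h0
    have h1 : g.form (φ.symm x) (ξ (φ.symm x)) (ξ (φ.symm x)) < 0 := hp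
    rw [g.form_field_eq hφ hx] at h1
    simp [hL, h0] at h1
  refine ⟨⟨fun μ ↦ pd μ f x / (2 * f x), fun μ ν ↦ ?_⟩, ?_⟩
  · rw [hFx, hL, hL]; field_simp
  have hpdF : ∀ α β ν, pd α (g.nablaField φ ξ β ν) x =
      (1 / 2) * (pd α (pd β f) x * pd ν τ x + pd β f x * pd α (pd ν τ) x -
        (pd α (pd ν f) x * pd β τ x + pd ν f x * pd α (pd β τ) x)) := by
    intro α β ν
    have h1 := fun μ ↦ (hf.pd μ).differentiableAt_infty
    have h2 := fun μ ↦ (hτ.pd μ).differentiableAt_infty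
    rw [pd_congr (hF.mono fun z hz ↦ hz β ν) α,
      pd_const_mul (((h1 _).fun_mul (h2 _)).fun_sub ((h1 _).fun_mul (h2 _))),
      pd_sub ((h1 _).fun_mul (h2 _)) ((h1 _).fun_mul (h2 _)), pd_mul (h1 _) (h2 _),
      pd_mul (h1 _) (h2 _)]
  -- the symmetric part of `∇_α ξ_ν = ∂_α f ∂_ν τ + f ∇_α ∇_ν τ` vanishes, which determines `∇∇τ`
  have hhess : ∀ α ν, f x * (pd α (pd ν τ) x - ∑ σ, g.christoffel φ σ α ν x * pd σ τ x) =
      -(1 / 2) * (pd α f x * pd ν τ x + pd ν f x * pd α τ x) := by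
    intro α ν
    have h1 := hFx α ν
    rw [nablaField, hpdL.self_of_nhds] at h1
    simp only [hL, mul_left_comm _ (f x), ← Finset.mul_sum] at h1
    linarith
  refine ⟨fun α ν ↦ ((1 / 2) * (pd α (pd ν f) x - ∑ σ, g.christoffel φ σ α ν x * pd σ f x)
    - (1 / 4) * pd α f x * pd ν f x / f x) / f x, fun ν α β ↦ ?_⟩
  rw [g.sum_fieldComp_mul_riemann, g.sum_riemannMixed_mul_fieldLow hξ hφ hx, hL, hL]
  have hs : ∀ α β, ∑ σ, g.christoffel φ σ α ν x * g.nablaField φ ξ β σ x =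
      (1 / 2) * (pd β f x * (∑ σ, g.christoffel φ σ α ν x * pd σ τ x)
        - pd β τ x * ∑ σ, g.christoffel φ σ α ν x * pd σ f x) := by
    intro α β
    simp only [hFx, Finset.mul_sum, ← Finset.sum_sub_distrib]
    exact Finset.sum_congr rfl fun σ _ ↦ by ring
  rw [Finset.sum_sub_distrib, hs, hs, hpdF, hpdF, pd_pd_comm hf β α, pd_pd_comm hτ β α]
  have e1 := hhess α ν
  have e2 := hhess β ν
  generalize (∑ σ, g.christoffel φ σ α ν x * pd σ τ x) = A at *
  generalize (∑ σ, g.christoffel φ σ β ν x * pd σ τ x) = B at *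
  have e3 : pd α (pd ν τ) x = A - (1 / 2) * (pd α f x * pd ν τ x + pd ν f x * pd α τ x) / f x := by
    field_simp; linarith
  have e4 : pd β (pd ν τ) x = B - (1 / 2) * (pd β f x * pd ν τ x + pd ν f x * pd β τ x) / f x := by
    field_simp; linarith
  rw [e3, e4]
  field_simp
  ring

/-- The hypersurfaces orthogonal to a static Killing field are totally geodesic: on vectors
orthogonal to `ξ`, both `w ∧ ξ` and the term from differentiating the norm of `ξ` vanish. -/
lemma extrinsicCurvature_eq_zero (hp : φ.symm x ∈ g.timelikeRegion ξ)
    {X Y : TangentSpace (𝓡 4) (φ.symm x)} (hX : g.form (φ.symm x) (ξ (φ.symm x)) X = 0)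
    (hY : g.form (φ.symm x) (ξ (φ.symm x)) Y = 0) :
    g.extrinsicCurvature φ ξ (φ.symm x) X Y = 0 := by
  obtain ⟨⟨w, hw⟩, -⟩ := g.exists_nablaField_eq_and_riemann_eq hξ hφ hx hp
  rw [g.form_field_eq hφ hx] at hX hY
  set s : CoordSpace → ℝ := fun y ↦ (√(-(g.form (φ.symm y) (ξ (φ.symm y)) (ξ (φ.symm y)))))⁻¹
  have hN : ContDiffAt ℝ ∞ (fun y ↦ g.form (φ.symm y) (ξ (φ.symm y)) (ξ (φ.symm y))) x := by
    have h1 : ContDiffAt ℝ ∞ (fun y ↦ ∑ μ, g.fieldLow φ ξ μ y * fieldComp φ ξ μ y) x :=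
      ContDiffAt.sum fun μ _ ↦ (g.contDiffAt_fieldLow hξ hφ hx μ).mul
        (contDiffAt_fieldComp hξ.smooth hφ hx μ)
    refine h1.congr_of_eventuallyEq ?_
    filter_upwards [φ.open_target.mem_nhds hx] with y hy using g.form_field_eq hφ hy _
  have hpos : 0 < -(g.form (φ.symm x) (ξ (φ.symm x)) (ξ (φ.symm x))) := neg_pos.mpr hp
  have hs : DifferentiableAt ℝ s x :=
    ((hN.neg.sqrt hpos.ne').inv (Real.sqrt_pos.mpr hpos).ne').differentiableAt_infty
  have hL := fun μ ↦ (g.contDiffAt_fieldLow hξ hφ hx μ).differentiableAt_infty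
  have hn : ∀ ν y, g.unitNormal φ ξ ν y = s y * g.fieldLow φ ξ ν y := fun ν y ↦ by
    rw [unitNormal, div_eq_inv_mul, fieldLow]
  have hterm : ∀ μ ν, pd μ (g.unitNormal φ ξ ν) x
      - ∑ σ, g.christoffel φ σ μ ν x * g.unitNormal φ ξ σ x =
      pd μ s x * g.fieldLow φ ξ ν x + s x * (w μ * g.fieldLow φ ξ ν x
        - w ν * g.fieldLow φ ξ μ x) := by
    intro μ ν
    rw [← hw, nablaField, pd_congr (Filter.Eventually.of_forall (hn ν)), pd_mul hs (hL ν)]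
    simp only [hn, mul_left_comm _ (s x), ← Finset.mul_sum]
    ring
  rw [extrinsicCurvature, φ.right_inv hx]
  simp only [hterm]
  calc _ = (∑ μ, vecComp φ (φ.symm x) X μ * (pd μ s x + s x * w μ)) *
        (∑ ν, g.fieldLow φ ξ ν x * vecComp φ (φ.symm x) Y ν) -
        (∑ μ, g.fieldLow φ ξ μ x * vecComp φ (φ.symm x) X μ) *
        (∑ ν, s x * w ν * vecComp φ (φ.symm x) Y ν) := by
        simp only [Finset.sum_mul_sum, ← Finset.sum_sub_distrib]
        exact Finset.sum_congr rfl fun μ _ ↦ Finset.sum_congr rfl fun ν _ ↦ by ring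
    _ = 0 := by rw [hX, hY]; ring

end LorentzianMetric
end

/-! ### Existence of static frames -/

/-- The Lorentz boost taking the time axis to the unit timelike vector with components `(γ, u)`. -/
noncomputable def boost (γ : ℝ) (u : Fin 3 → ℝ) : Fin 4 → Fin 4 → ℝ :=
  Fin.cons (Fin.cons γ u) fun i ↦
    Fin.cons (u i) fun j ↦ (if i = j then 1 else 0) + (1 + γ)⁻¹ * u i * u j

lemma frameForm_minkowskiEta (E : Fin 4 → Fin 4 → ℝ) (a b : Fin 4) :
    frameForm minkowskiEta E a b =
      -(E a 0 * E b 0) + ∑ i : Fin 3, E a i.succ * E b i.succ := by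
  have h : ∀ μ, ∑ ν, minkowskiEta μ ν * (E a μ * E b ν) = signEta μ * (E a μ * E b μ) := by
    intro μ
    simp [minkowskiEta, signEta]
  simp only [frameForm, h, Fin.sum_univ_succ (n := 3), signEta, Fin.succ_ne_zero, if_true, if_false,
    one_mul, neg_mul]

lemma frameForm_boost {γ : ℝ} (u : Fin 3 → ℝ) (hγ : 0 < γ) (hu : ∑ i, u i ^ 2 = γ ^ 2 - 1)
    (a b : Fin 4) : frameForm minkowskiEta (boost γ u) a b = minkowskiEta a b := by
  have hne : 1 + γ ≠ 0 := by positivity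
  rw [frameForm_minkowskiEta]
  have h1 : (1 + γ)⁻¹ * (1 + γ) = 1 := inv_mul_cancel₀ hne
  have h2 : (1 + γ)⁻¹ * ∑ i, u i ^ 2 = γ - 1 := by
    rw [hu]; field_simp; ring
  have h3 : ∀ i : Fin 3, ∑ κ, u κ * ((if i = κ then 1 else 0) + (1 + γ)⁻¹ * u i * u κ) =
      u i + u i * ((1 + γ)⁻¹ * ∑ κ, u κ ^ 2) := by
    intro i
    simp only [mul_add, Finset.sum_add_distrib, Finset.mul_sum]
    congr 1
    · simp
    · exact Finset.sum_congr rfl fun κ _ ↦ by ring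
  have h4 : ∀ i j : Fin 3, ∑ κ, ((if i = κ then 1 else 0) + (1 + γ)⁻¹ * u i * u κ) *
      ((if j = κ then 1 else 0) + (1 + γ)⁻¹ * u j * u κ) =
      (if i = j then 1 else 0) + 2 * ((1 + γ)⁻¹ * u i * u j) +
        (1 + γ)⁻¹ * u i * u j * ((1 + γ)⁻¹ * ∑ κ, u κ ^ 2) := by
    intro i j
    have h5 : ∀ κ : Fin 3, ((if i = κ then 1 else 0) + (1 + γ)⁻¹ * u i * u κ) *
      ((if j = κ then 1 else 0) + (1 + γ)⁻¹ * u j * u κ) =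
        (if i = κ then (if j = κ then 1 else 0) + (1 + γ)⁻¹ * u j * u κ else 0) +
        (if j = κ then (1 + γ)⁻¹ * u i * u κ else 0) +
        (1 + γ)⁻¹ * u i * u j * ((1 + γ)⁻¹ * u κ ^ 2) := by
      intro κ
      split_ifs <;> ring
    simp only [h5, Finset.sum_add_distrib, ← Finset.mul_sum, Finset.sum_ite_eq, Finset.mem_univ,
      if_true, eq_comm (a := j) (b := i)]
    ring
  refine Fin.cases ?_ (fun i ↦ ?_) a <;> refine Fin.cases ?_ (fun j ↦ ?_) b <;>
    simp only [boost, Fin.cons_zero, Fin.cons_succ, minkowskiEta, Fin.succ_ne_zero,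
      (Fin.succ_ne_zero _).symm, Fin.succ_inj, if_true, if_false, ← sq, h3, h4, h2]
  · rw [hu]; ring
  · ring
  · rw [Finset.sum_congr rfl fun κ _ ↦ mul_comm _ (u κ), h3, h2]; ring
  · linear_combination u i * u j * h1

namespace LorentzianMetric

variable {M : Type*} [TopologicalSpace M] [ChartedSpace CoordSpace M] [IsManifold (𝓡 4) ∞ M]
  (g : LorentzianMetric M)

lemma exists_isStaticFrame {ξ : ∀ p : M, TangentSpace (𝓡 4) p} {p : M}
    (hp : p ∈ g.timelikeRegion ξ) : ∃ e, g.IsStaticFrame ξ p e := by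
  obtain ⟨b, hb⟩ := g.signature p
  have hform : ∀ E : Fin 4 → Fin 4 → ℝ, ∀ a c,
      g.form p (∑ μ, E a μ • b μ) (∑ ν, E c ν • b ν) = frameForm minkowskiEta E a c := by
    intro E a c
    simp only [map_sum, sum_apply, map_smul, smul_apply, smul_eq_mul, Finset.mul_sum, hb, frameForm]
    rw [Finset.sum_comm]
    exact Finset.sum_congr rfl fun μ _ ↦ Finset.sum_congr rfl fun ν _ ↦ by ring
  set v : Fin 4 → ℝ := fun a ↦ b.repr (ξ p) a
  have hv : ∑ a, v a • b a = ξ p := b.sum_repr (ξ p)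
  have hlt : -(v 0 * v 0) + ∑ i : Fin 3, v i.succ * v i.succ < 0 := by
    have h1 : g.form p (ξ p) (ξ p) < 0 := hp
    rwa [← hv, hform (fun _ ↦ v) 0 0, frameForm_minkowskiEta] at h1
  set N : ℝ := v 0 * v 0 - ∑ i : Fin 3, v i.succ * v i.succ
  have hN : 0 < N := by simp only [N]; linarith
  have hsum : 0 ≤ ∑ i : Fin 3, v i.succ * v i.succ :=
    Finset.sum_nonneg fun i _ ↦ mul_self_nonneg _
  have hv0 : v 0 ≠ 0 := by
    intro h0
    rw [h0] at hlt
    linarith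
  -- the normalization, with the sign that makes the frame's time axis point along `b 0`
  obtain ⟨c, hcv, hcN⟩ : ∃ c : ℝ, 0 < c * v 0 ∧ c ^ 2 * N = 1 := by
    rcases lt_or_gt_of_ne hv0 with h | h
    · refine ⟨-(√N)⁻¹, ?_, ?_⟩
      · have : 0 < (√N)⁻¹ := inv_pos.mpr (Real.sqrt_pos.mpr hN)
        nlinarith
      · rw [neg_sq, inv_pow, Real.sq_sqrt hN.le, inv_mul_cancel₀ hN.ne']
    · refine ⟨(√N)⁻¹, by positivity, ?_⟩
      rw [inv_pow, Real.sq_sqrt hN.le, inv_mul_cancel₀ hN.ne']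
  have hu : ∑ i : Fin 3, (c * v i.succ) ^ 2 = (c * v 0) ^ 2 - 1 := by
    have h1 : ∑ i : Fin 3, (c * v i.succ) ^ 2 = c ^ 2 * ∑ i : Fin 3, v i.succ * v i.succ := by
      rw [Finset.mul_sum]
      exact Finset.sum_congr rfl fun i _ ↦ by ring
    rw [h1, ← hcN]; simp only [N]; ring
  refine ⟨fun a ↦ ∑ μ, boost (c * v 0) (fun i ↦ c * v i.succ) a μ • b μ, fun a d ↦ ?_, c, ?_⟩
  · exact (hform _ a d).trans (frameForm_boost _ hcv hu a d)
  · rw [← hv, Finset.smul_sum]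
    refine Finset.sum_congr rfl fun μ _ ↦ ?_
    rw [smul_smul]
    congr 1
    exact Fin.cases rfl (fun i ↦ rfl) μ

/-! ### Curvature in a static frame -/

variable {φ : OpenPartialHomeomorph M CoordSpace} {x : CoordSpace} {E : Fin 4 → Fin 4 → ℝ}

/-- The Ricci tensor in an orthonormal frame is the signed trace of the Riemann tensor. -/
lemma frameForm_ricci (hφ : φ ∈ IsManifold.maximalAtlas (𝓡 4) ∞ M) (hx : x ∈ φ.target)
    (hE : ∀ a b, frameForm (g.lower φ x) E a b = minkowskiEta a b) (b d : Fin 4) :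
    frameForm (g.ricci φ x) E b d =
      ∑ a, signEta a * frameTensor (g.riemann φ x) E a b a d := by
  have hup := (inv_eq_of_frameForm hE).2
  change ∀ μ ν, g.upper φ x μ ν = _ at hup
  have h1 : ∀ a, signEta a * frameTensor (g.riemann φ x) E a b a d =
      ∑ μ, ∑ ν, ∑ σ, ∑ ρ, signEta a * E a σ * E a ρ * g.riemann φ x ρ μ σ ν *
        (E b μ * E d ν) := by
    intro a
    have h2 : ∀ f : Fin 4 → Fin 4 → Fin 4 → Fin 4 → ℝ,
        ∑ ρ, ∑ μ, ∑ σ, ∑ ν, f ρ μ σ ν = ∑ μ, ∑ ν, ∑ σ, ∑ ρ, f ρ μ σ ν := by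
      intro f
      rw [Finset.sum_comm]
      refine Finset.sum_congr rfl fun μ _ ↦ ?_
      rw [Finset.sum_comm, Finset.sum_comm (s := Finset.univ) (t := Finset.univ)
        (f := fun ν σ ↦ ∑ ρ, f ρ μ σ ν)]
      refine Finset.sum_congr rfl fun σ _ ↦ ?_
      rw [Finset.sum_comm]
    rw [frameTensor, h2]
    simp only [Finset.mul_sum]
    exact Finset.sum_congr rfl fun μ _ ↦ Finset.sum_congr rfl fun ν _ ↦
      Finset.sum_congr rfl fun σ _ ↦ Finset.sum_congr rfl fun ρ _ ↦ by ring
  simp only [h1, frameForm]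
  symm
  rw [Finset.sum_comm]
  refine Finset.sum_congr rfl fun μ _ ↦ ?_
  rw [Finset.sum_comm]
  refine Finset.sum_congr rfl fun ν _ ↦ ?_
  rw [g.ricci_eq hφ hx, Finset.sum_mul, Finset.sum_comm]
  refine Finset.sum_congr rfl fun σ _ ↦ ?_
  rw [Finset.sum_mul, Finset.sum_comm]
  refine Finset.sum_congr rfl fun ρ _ ↦ ?_
  rw [hup, Finset.sum_mul, Finset.sum_mul]

/-- The Weyl tensor in an orthonormal frame. -/
lemma frameTensor_weyl (hE : ∀ a b, frameForm (g.lower φ x) E a b = minkowskiEta a b)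
    (a b c d : Fin 4) :
    frameTensor (g.weyl φ x) E a b c d = frameTensor (g.riemann φ x) E a b c d
      - (1 / 2) * (minkowskiEta a c * frameForm (g.ricci φ x) E b d
        - minkowskiEta a d * frameForm (g.ricci φ x) E b c
        - frameForm (g.ricci φ x) E a d * minkowskiEta b c
        + frameForm (g.ricci φ x) E a c * minkowskiEta b d)
      + (1 / 6) * g.ricciScalar φ x *
        (minkowskiEta a c * minkowskiEta b d - minkowskiEta a d * minkowskiEta b c) := by
  have h : g.weyl φ x = fun μ ν α β ↦ g.riemann φ x μ ν α β
    - (1 / 2) * (g.lower φ x μ α * g.ricci φ x ν β - g.lower φ x μ β * g.ricci φ x ν α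
      - g.ricci φ x μ β * g.lower φ x ν α + g.ricci φ x μ α * g.lower φ x ν β)
    + (1 / 6) * g.ricciScalar φ x *
      (g.lower φ x μ α * g.lower φ x ν β - g.lower φ x μ β * g.lower φ x ν α) := by
    funext μ ν α β
    simp only [weyl]; ring
  have hs : ∀ A B : Fin 4 → Fin 4 → ℝ, frameTensor (fun μ ν α β ↦ A μ β * B ν α) E a b c d =
      frameForm A E a d * frameForm B E b c := fun A B ↦ by
    rw [← frameTensor_mul_frameForm]
    exact frameTensor_swap (fun μ ν α β ↦ A μ α * B ν β) E a b c d
  rw [h, frameTensor_add, frameTensor_sub, frameTensor_const_mul, frameTensor_const_mul,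
    frameTensor_add, frameTensor_sub, frameTensor_sub, frameTensor_sub]
  have e1 := frameTensor_mul_frameForm (g.lower φ x) (g.ricci φ x) E a b c d
  have e2 := hs (g.lower φ x) (g.ricci φ x)
  have e3 := hs (g.ricci φ x) (g.lower φ x)
  have e4 := frameTensor_mul_frameForm (g.ricci φ x) (g.lower φ x) E a b c d
  have e5 := frameTensor_mul_frameForm (g.lower φ x) (g.lower φ x) E a b c d
  have e6 := hs (g.lower φ x) (g.lower φ x)
  simp only [hE] at e1 e2 e3 e4 e5 e6
  rw [e1, e2, e3, e4, e5, e6]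

variable {ξ : ∀ p : M, TangentSpace (𝓡 4) p}

/-- In a static frame the components of the Riemann tensor with exactly one time index vanish. -/
lemma frameTensor_riemann_eq_zero (hξ : g.IsStaticKilling ξ)
    (hφ : φ ∈ IsManifold.maximalAtlas (𝓡 4) ∞ M) (hx : x ∈ φ.target)
    (hp : φ.symm x ∈ g.timelikeRegion ξ) {c : ℝ} (h0 : ∀ μ, E 0 μ = c * fieldComp φ ξ μ x)
    (hperp : ∀ i : Fin 3, ∑ μ, g.fieldLow φ ξ μ x * E i.succ μ = 0) (i j k : Fin 3) :
    frameTensor (g.riemann φ x) E 0 i.succ j.succ k.succ = 0 := by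
  obtain ⟨V, hV⟩ := (g.exists_nablaField_eq_and_riemann_eq hξ hφ hx hp).2
  calc frameTensor (g.riemann φ x) E 0 i.succ j.succ k.succ
      = c * ∑ ν, ∑ α, ∑ β, (∑ μ, fieldComp φ ξ μ x * g.riemann φ x μ ν α β) *
          (E i.succ ν * E j.succ α * E k.succ β) := by
        simp only [frameTensor, h0, Finset.mul_sum, Finset.sum_mul]
        rw [Finset.sum_comm]
        refine Finset.sum_congr rfl fun ν _ ↦ ?_
        rw [Finset.sum_comm]
        refine Finset.sum_congr rfl fun α _ ↦ ?_
        rw [Finset.sum_comm]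
        exact Finset.sum_congr rfl fun β _ ↦ Finset.sum_congr rfl fun μ _ ↦ by ring
    _ = c * ∑ ν, E i.succ ν * ((∑ α, V α ν * E j.succ α) *
          (∑ β, g.fieldLow φ ξ β x * E k.succ β) - (∑ α, g.fieldLow φ ξ α x * E j.succ α) *
          ∑ β, V β ν * E k.succ β) := by
        congr 1
        refine Finset.sum_congr rfl fun ν _ ↦ ?_
        rw [Finset.sum_mul_sum, Finset.sum_mul_sum, ← Finset.sum_sub_distrib, Finset.mul_sum]
        refine Finset.sum_congr rfl fun α _ ↦ ?_
        rw [← Finset.sum_sub_distrib, Finset.mul_sum]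
        exact Finset.sum_congr rfl fun β _ ↦ by rw [hV]; ring
    _ = 0 := by simp only [hperp, mul_zero, zero_mul, sub_zero, Finset.sum_const_zero]

/-- In an orthonormal frame in which the components of the Riemann tensor with exactly one time
index vanish, so do those of the Weyl tensor. -/
lemma frameTensor_weyl_eq_zero (hφ : φ ∈ IsManifold.maximalAtlas (𝓡 4) ∞ M) (hx : x ∈ φ.target)
    (hE : ∀ a b, frameForm (g.lower φ x) E a b = minkowskiEta a b)
    (hR : ∀ i j k : Fin 3, frameTensor (g.riemann φ x) E 0 i.succ j.succ k.succ = 0)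
    (i j k : Fin 3) : frameTensor (g.weyl φ x) E 0 i.succ j.succ k.succ = 0 := by
  have hS := (g.riemann_isCurvatureLike hφ hx).frameTensor E
  have hric : ∀ k : Fin 3, frameForm (g.ricci φ x) E 0 k.succ = 0 := by
    intro k
    rw [g.frameForm_ricci hφ hx hE, Fin.sum_univ_succ]
    have h1 : frameTensor (g.riemann φ x) E 0 0 0 k.succ = 0 := by
      linarith [hS.antisymm_left 0 0 0 k.succ]
    have h2 : ∀ i : Fin 3, frameTensor (g.riemann φ x) E i.succ 0 i.succ k.succ = 0 := fun i ↦ by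
      rw [hS.antisymm_left, hR, neg_zero]
    simp only [h1, h2, mul_zero, Finset.sum_const_zero, add_zero]
  have h0 : ∀ i : Fin 3, minkowskiEta 0 i.succ = 0 := fun i ↦ if_neg (Fin.succ_ne_zero i).symm
  rw [g.frameTensor_weyl hE, hR, hric, hric, h0, h0]
  ring

end LorentzianMetric

/-- A curvature-like tensor whose components with exactly one time index vanish in an orthonormal
frame has a full contraction equal to the sum of squares of its frame components. -/
lemma IsCurvatureLike.fullContraction_eq {G : Matrix (Fin 4) (Fin 4) ℝ} {E : Fin 4 → Fin 4 → ℝ}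
    (hE : ∀ a b, frameForm G E a b = minkowskiEta a b)
    {T : Fin 4 → Fin 4 → Fin 4 → Fin 4 → ℝ} (hT : IsCurvatureLike T)
    (h0 : ∀ i j k : Fin 3, _root_.frameTensor T E 0 i.succ j.succ k.succ = 0) :
    fullContraction G⁻¹ T = (∑ i : Fin 3, ∑ j : Fin 3, ∑ k : Fin 3, ∑ l : Fin 3,
        _root_.frameTensor T E i.succ j.succ k.succ l.succ ^ 2)
      + 4 * (∑ i : Fin 3, ∑ j : Fin 3, _root_.frameTensor T E 0 i.succ 0 j.succ ^ 2) ∧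
    fullContraction G⁻¹ T = ∑ a, ∑ b, ∑ c, ∑ d, _root_.frameTensor T E a b c d ^ 2 := by
  have h := (hT.frameTensor E).signed_sum_sq h0
  rw [fullContraction_eq_sum_frameTensor _ E (inv_eq_of_frameForm hE).2]
  exact ⟨h.1, h.1.trans h.2.symm⟩

lemma sum_sq_nonneg (S : Fin 4 → Fin 4 → Fin 4 → Fin 4 → ℝ) :
    0 ≤ ∑ a, ∑ b, ∑ c, ∑ d, S a b c d ^ 2 := by positivity

/-! ### The curvature scalars in the static region -/

theorem theorem1p1 {M : Type*} [TopologicalSpace M] [ChartedSpace CoordSpace M]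
    [IsManifold (𝓡 4) ∞ M] (g : LorentzianMetric M)
    (ξ : ∀ p : M, TangentSpace (𝓡 4) p) (hξ : g.IsStaticKilling ξ)
    -- arbitrary coordinates `φ p` around each point `p`, in which the curvature at `p` is computed
    (φ : M → OpenPartialHomeomorph M CoordSpace)
    (hφ : ∀ p, φ p ∈ IsManifold.maximalAtlas (𝓡 4) ∞ M ∧ p ∈ (φ p).source) :
    -- pointwise statements in the strictly static region
    (∀ p ∈ g.timelikeRegion ξ,
      (∃ e, g.IsStaticFrame ξ p e) ∧
      (∀ X Y : TangentSpace (𝓡 4) p, g.form p (ξ p) X = 0 → g.form p (ξ p) Y = 0 →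
        g.extrinsicCurvature (φ p) ξ p X Y = 0) ∧
      0 ≤ g.kretschmann (φ p) p ∧
      0 ≤ g.weylScalar (φ p) p ∧
      ∀ e, g.IsStaticFrame ξ p e →
        let R := frameComp (φ p) p (g.riemann (φ p) (φ p p)) e
        let C := frameComp (φ p) p (g.weyl (φ p) (φ p p)) e
        (∀ i j k : Fin 3, R 0 i.succ j.succ k.succ = 0) ∧
        (∀ i j k : Fin 3, C 0 i.succ j.succ k.succ = 0) ∧
        g.kretschmann (φ p) p =
          (∑ i : Fin 3, ∑ j : Fin 3, ∑ k : Fin 3, ∑ l : Fin 3, R i.succ j.succ k.succ l.succ ^ 2)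
            + 4 * (∑ i : Fin 3, ∑ j : Fin 3, R 0 i.succ 0 j.succ ^ 2) ∧
        g.kretschmann (φ p) p = ∑ a, ∑ b, ∑ c, ∑ d, R a b c d ^ 2 ∧
        g.weylScalar (φ p) p =
          (∑ i : Fin 3, ∑ j : Fin 3, ∑ k : Fin 3, ∑ l : Fin 3, C i.succ j.succ k.succ l.succ ^ 2)
            + 4 * (∑ i : Fin 3, ∑ j : Fin 3, C 0 i.succ 0 j.succ ^ 2) ∧
        g.weylScalar (φ p) p = ∑ a, ∑ b, ∑ c, ∑ d, C a b c d ^ 2 ∧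
        (∀ a b c d, |R a b c d| ≤ √(g.kretschmann (φ p) p)) ∧
        (∀ a b c d, |C a b c d| ≤ √(g.weylScalar (φ p) p))) ∧
    -- finiteness on the whole strictly static region, or on any part of it
    (∀ S ⊆ g.timelikeRegion ξ,
      (BddAbove ((fun p ↦ g.kretschmann (φ p) p) '' S) →
        ∃ B : ℝ, ∀ p ∈ S, ∀ e, g.IsStaticFrame ξ p e → ∀ a b c d,
          |frameComp (φ p) p (g.riemann (φ p) (φ p p)) e a b c d| ≤ B) ∧
      (BddAbove ((fun p ↦ g.weylScalar (φ p) p) '' S) →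
        ∃ B : ℝ, ∀ p ∈ S, ∀ e, g.IsStaticFrame ξ p e → ∀ a b c d,
          |frameComp (φ p) p (g.weyl (φ p) (φ p p)) e a b c d| ≤ B)) := by
  have hpt : ∀ p ∈ g.timelikeRegion ξ, ∀ e, g.IsStaticFrame ξ p e →
      ∃ E : Fin 4 → Fin 4 → ℝ, (∀ a b, frameForm (g.lower (φ p) (φ p p)) E a b = minkowskiEta a b) ∧
        (∀ T, frameComp (φ p) p T e = frameTensor T E) ∧
        ∀ i j k : Fin 3,
          frameTensor (g.riemann (φ p) (φ p p)) E 0 i.succ j.succ k.succ = 0 := by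
    intro p hp e he
    obtain ⟨hmem, hsrc⟩ := hφ p
    generalize φ p = ψ at *
    obtain ⟨x, hx, rfl⟩ : ∃ x ∈ ψ.target, ψ.symm x = p :=
      ⟨ψ p, ψ.map_source hsrc, ψ.left_inv hsrc⟩
    rw [ψ.right_inv hx]
    obtain ⟨c, hc⟩ := he.adapted
    refine ⟨fun a ↦ vecComp ψ (ψ.symm x) (e a), fun a b ↦ ?_, fun T ↦ rfl, ?_⟩
    · rw [← he.orthonormal, g.form_eq_sum hmem hx]
      rfl
    · refine g.frameTensor_riemann_eq_zero hξ hmem hx hp (c := c) (fun μ ↦ ?_) fun i ↦ ?_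
      · rw [hc, fieldComp, vecComp_eq_chartDeriv, vecComp_eq_chartDeriv, map_smul]
        rfl
      · rw [← g.form_field_eq hmem hx]
        -- `e 0 = c • ξ` with `c ≠ 0`, so that `e_i ⟂ e_0` gives `e_i ⟂ ξ`
        have h1 := he.orthonormal 0 0
        have h2 := he.orthonormal 0 i.succ
        rw [hc] at h1
        rw [hc, map_smul, smul_apply, smul_eq_mul] at h2
        have hc0 : c ≠ 0 := by
          rintro rfl
          simp [minkowskiEta] at h1
        rw [minkowskiEta, if_neg (Fin.succ_ne_zero i).symm] at h2
        exact (mul_eq_zero.mp h2).resolve_left hc0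
  have htgt : ∀ p, φ p p ∈ (φ p).target := fun p ↦ (φ p).map_source (hφ p).2
  have hfr : ∀ p ∈ g.timelikeRegion ξ, ∀ e, g.IsStaticFrame ξ p e →
        let R := frameComp (φ p) p (g.riemann (φ p) (φ p p)) e
        let C := frameComp (φ p) p (g.weyl (φ p) (φ p p)) e
        (∀ i j k : Fin 3, R 0 i.succ j.succ k.succ = 0) ∧
        (∀ i j k : Fin 3, C 0 i.succ j.succ k.succ = 0) ∧
        g.kretschmann (φ p) p =
          (∑ i : Fin 3, ∑ j : Fin 3, ∑ k : Fin 3, ∑ l : Fin 3, R i.succ j.succ k.succ l.succ ^ 2)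
            + 4 * (∑ i : Fin 3, ∑ j : Fin 3, R 0 i.succ 0 j.succ ^ 2) ∧
        g.kretschmann (φ p) p = ∑ a, ∑ b, ∑ c, ∑ d, R a b c d ^ 2 ∧
        g.weylScalar (φ p) p =
          (∑ i : Fin 3, ∑ j : Fin 3, ∑ k : Fin 3, ∑ l : Fin 3, C i.succ j.succ k.succ l.succ ^ 2)
            + 4 * (∑ i : Fin 3, ∑ j : Fin 3, C 0 i.succ 0 j.succ ^ 2) ∧
        g.weylScalar (φ p) p = ∑ a, ∑ b, ∑ c, ∑ d, C a b c d ^ 2 ∧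
        (∀ a b c d, |R a b c d| ≤ √(g.kretschmann (φ p) p)) ∧
        (∀ a b c d, |C a b c d| ≤ √(g.weylScalar (φ p) p)) := by
    intro p hp e he
    obtain ⟨E, hE, hT, hR⟩ := hpt p hp e he
    have hC := g.frameTensor_weyl_eq_zero (hφ p).1 (htgt p) hE hR
    have hK := (g.riemann_isCurvatureLike (hφ p).1 (htgt p)).fullContraction_eq hE hR
    have hW := (g.weyl_isCurvatureLike (hφ p).1 (htgt p)).fullContraction_eq hE hC
    simp only [hT]
    refine ⟨hR, hC, hK.1, hK.2, hW.1, hW.2, fun a b c d ↦ ?_, fun a b c d ↦ ?_⟩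
    · exact (abs_le_sqrt_sum_sq _ a b c d).trans (Real.sqrt_le_sqrt hK.2.ge)
    · exact (abs_le_sqrt_sum_sq _ a b c d).trans (Real.sqrt_le_sqrt hW.2.ge)
  refine ⟨fun p hp ↦ ?_, fun S hS ↦ ⟨fun hK ↦ ?_, fun hW ↦ ?_⟩⟩
  · obtain ⟨e, he⟩ := g.exists_isStaticFrame hp
    obtain ⟨-, -, -, hK, -, hW, -⟩ := hfr p hp e he
    refine ⟨⟨e, he⟩, fun X Y hX hY ↦ ?_, hK ▸ sum_sq_nonneg _, hW ▸ sum_sq_nonneg _, hfr p hp⟩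
    obtain ⟨hmem, hsrc⟩ := hφ p
    generalize φ p = ψ at *
    obtain ⟨x, hx, rfl⟩ : ∃ x ∈ ψ.target, ψ.symm x = p :=
      ⟨ψ p, ψ.map_source hsrc, ψ.left_inv hsrc⟩
    exact g.extrinsicCurvature_eq_zero hξ hmem hx hp hX hY
  · obtain ⟨b, hb⟩ := hK
    refine ⟨√b, fun p hp e he a b c d ↦ ?_⟩
    obtain ⟨-, -, -, -, -, -, h, -⟩ := hfr p (hS hp) e he
    exact (h a b c d).trans (Real.sqrt_le_sqrt (hb (Set.mem_image_of_mem _ hp)))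
  · obtain ⟨b, hb⟩ := hW
    refine ⟨√b, fun p hp e he a b c d ↦ ?_⟩
    obtain ⟨-, -, -, -, -, -, -, h⟩ := hfr p (hS hp) e he
    exact (h a b c d).trans (Real.sqrt_le_sqrt (hb (Set.mem_image_of_mem _ hp)))
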